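/- Let $A$ and $B_1,B_2,\dots$ be independent $\mathbb Z_+$-valued random variables, the $B_i$ being i.i.d. with the law of $B$, and let $X$ be a $\mathbb Z_+$-valued random variable independent of $(A,(B_i)_{i\ge1})$ with $$X=_{st}A+\sum_{i=1}^{X}B_i .$$ Assume $0<P(A=0)<1$, $P(B=0)<1$, $a:=E A<\infty$ and $0<b:=E B<1$. Let $G$ be a probability distribution on $\mathbb R$ with tail $\overline G(x)=G((x,\infty))$ such that $$\lim_{x\to\infty}\frac{P(A>x)}{\overline G(x)}=c_1,\qquad \lim_{x\to\infty}\frac{P(B>x)}{\overline G(x)}=c_2,\qquad c_1,c_2\ge 0,\quad c_1+c_2>0 .$$ Put $D=\frac{(1-b)c_1+ac_2}{1-b}$ and $T_c(x)=\sum_{n=0}^\infty\overline G(c^nx)$ for $c>1$, $x>0$ (these sums are finite). Notation, as $x\to\infty$: $f\sim g$, $f\gtrsim g$, $f\lesssim g$ mean $\lim f/g=1$, $\liminf f/g\ge 1$, $\limsup f/g\le1$, respectively. A distribution $F$ on $\mathbb R$ with tail $\overline F$ is in: - $\mathcal L$ if $\overline F(x+y)\sim\overline F(x)$ for every $y\in\mathbb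 R$; - $\mathcal S^*$ (strong subexponential) if $F\in\mathcal L$, $m:=\int_0^\infty\overline F(y)\,dy<\infty$ and $\int_0^x\overline F(y)\overline F(x-y)\,dy\sim 2m\overline F(x)$; - $\mathcal D$ if $\liminf_{x\to\infty}\overline F(yx)/\overline F(x)>0$ for some $y>1$; - $\mathcal{ERV}$ if there are $\alpha_+,\alpha_->0$ such that $y^{-\alpha_-}\le\liminf_{x\to\infty}\frac{\overline F(yx)}{\overline F(x)}\le\limsup_{x\to\infty}\frac{\overline F(yx)}{\overline F(x)}\le y^{-\alpha_+}$ for all $y\ge1$; - $\mathcal{RV}$ with index $\alpha>0$ if $\overline F(x)=x^{-\alpha}L(x)$ for $x>0$, where $L(cx)\sim L(x)$ for every $c>1$. Then: 1. If $G\in\mathcal S^*$, then $P(X>x)\gtrsim D\,T_{d}(x)$ for every $d>1/b$. 2. If $G\in\mathcal D\cap\mathcal L$, then $P(X>x)\lesssim D\,T_{d}(x)$ for every $1<d<1/b$. 3. If $G\in\mathcal D\cap\mathcal L$ and, with $c_0=1/b$, $$\lim_{c\uparrow c_0}\limsup_{x\to\infty}\frac{T_c(x)}{T_{c_0}(x)}=\lim_{c\downarrow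 c_0}\liminf_{x\to\infty}\frac{T_c(x)}{T_{c_0}(x)}=1,$$ then $P(X>x)\sim D\,T_{1/b}(x)$. 4. If $G\in\mathcal{ERV}$, then $P(X>x)\sim D\,T_{1/b}(x)$, and the distribution of $X$ is in $\mathcal{ERV}$. 5. If $G\in\mathcal{RV}$ with index $\alpha>0$, then the distribution of $X$ is in $\mathcal{RV}$ with the same index $\alpha$, and $$P(X>x)\sim\frac{(1-b)c_1+ac_2}{(1-b)(1-b^\alpha)}\,\overline G(x).$$ -/

import Mathlib

open MeasureTheory ProbabilityTheory Filter Topology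

namespace HeavyTail

noncomputable section

/-- `liminf_{x → ∞} f x / g x`, taken in the extended reals. -/
def ratioLiminf (f g : ℝ → ℝ) : EReal :=
  liminf (fun x : ℝ => ((f x / g x : ℝ) : EReal)) atTop

/-- `limsup_{x → ∞} f x / g x`, taken in the extended reals. -/
def ratioLimsup (f g : ℝ → ℝ) : EReal :=
  limsup (fun x : ℝ => ((f x / g x : ℝ) : EReal)) atTop

/-- Asymptotic equivalence `f ∼ g`: `lim_{x → ∞} f x / g x = 1`.
(This forces `f` and `g` to be nonzero for all large `x`.) -/
def AsympEq (f g : ℝ → ℝ) : Prop :=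
  Tendsto (fun x => f x / g x) atTop (𝓝 1)

/-- `f ≳ g`: `liminf_{x → ∞} f x / g x ≥ 1`. -/
def AsympGE (f g : ℝ → ℝ) : Prop := 1 ≤ ratioLiminf f g

/-- `f ≲ g`: `limsup_{x → ∞} f x / g x ≤ 1`. -/
def AsympLE (f g : ℝ → ℝ) : Prop := ratioLimsup f g ≤ 1

/-- The tail function `x ↦ G((x, ∞))` of a distribution `G` on `ℝ`. -/
def tail (G : Measure ℝ) (x : ℝ) : ℝ := G.real (Set.Ioi x)

/-- The class `L` of long-tailed distributions. -/
def IsLongTailed (G : Measure ℝ) : Prop :=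
  ∀ y : ℝ, AsympEq (fun x => tail G (x + y)) (tail G)

/-- The class `S*` of strong subexponential distributions. -/
def IsStrongSubexponential (G : Measure ℝ) : Prop :=
  IsLongTailed G ∧ IntegrableOn (tail G) (Set.Ioi 0) ∧
    AsympEq (fun x => ∫ y in (0 : ℝ)..x, tail G y * tail G (x - y))
      (fun x => 2 * (∫ y in Set.Ioi (0 : ℝ), tail G y) * tail G x)

/-- The class `D` of dominantly varying distributions. -/
def IsDominantlyVarying (G : Measure ℝ) : Prop :=
  ∃ y : ℝ, 1 < y ∧ 0 < ratioLiminf (fun x => tail G (y * x)) (tail G)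

/-- The class `ERV` of extended regularly varying distributions. -/
def IsERV (G : Measure ℝ) : Prop :=
  ∃ αp αm : ℝ, 0 < αp ∧ 0 < αm ∧ ∀ y : ℝ, 1 ≤ y →
    ((y ^ (-αm) : ℝ) : EReal) ≤ ratioLiminf (fun x => tail G (y * x)) (tail G) ∧
    ratioLimsup (fun x => tail G (y * x)) (tail G) ≤ ((y ^ (-αp) : ℝ) : EReal)

/-- Slow variation at infinity. -/
def IsSlowlyVarying (L : ℝ → ℝ) : Prop :=
  ∀ c : ℝ, 1 < c → AsympEq (fun x => L (c * x)) L

/-- The class `RV` of regularly varying distributions, with index `α > 0`. -/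
def IsRV (G : Measure ℝ) (α : ℝ) : Prop :=
  0 < α ∧ ∃ L : ℝ → ℝ, IsSlowlyVarying L ∧ ∀ x : ℝ, 0 < x → tail G x = x ^ (-α) * L x

/-- `T_c(x) = ∑_{n ≥ 0} tail G (c ^ n x)`. -/
def geomTailSum (G : Measure ℝ) (c x : ℝ) : ℝ := ∑' n : ℕ, tail G (c ^ n * x)

/-- Continuity of `c ↦ T_c` at `c₀` in the asymptotic sense:
`lim_{c ↑ c₀} limsup_{x → ∞} T_c(x) / T_{c₀}(x) = 1` and
`lim_{c ↓ c₀} liminf_{x → ∞} T_c(x) / T_{c₀}(x) = 1`. -/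
def GeomTailSumContinuousAt (G : Measure ℝ) (c₀ : ℝ) : Prop :=
  Tendsto (fun c => ratioLimsup (geomTailSum G c) (geomTailSum G c₀)) (𝓝[<] c₀) (𝓝 1) ∧
  Tendsto (fun c => ratioLiminf (geomTailSum G c) (geomTailSum G c₀)) (𝓝[>] c₀) (𝓝 1)

/-- `X` solves `X =_st A + ∑_{i ≤ X} B_i`, where `A, B_1, B_2, …, X` are `ℕ`-valued random
variables, the `B_i` are i.i.d. and independent of `A`, and `X` is independent of the pair
formed by `A` and the whole sequence `(B_i)`. The sequence is indexed from `0`. -/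
structure IsFixedPoint {Ω : Type*} [MeasurableSpace Ω] (P : Measure Ω)
    (A : Ω → ℕ) (B : ℕ → Ω → ℕ) (X : Ω → ℕ) : Prop where
  measurable_A : Measurable A
  measurable_B : ∀ i, Measurable (B i)
  measurable_X : Measurable X
  indep_B : iIndepFun B P
  identDistrib_B : ∀ i, IdentDistrib (B i) (B 0) P P
  indep_A_B : IndepFun A (fun ω i => B i ω) P
  indep_X : IndepFun X (fun ω => (A ω, fun i => B i ω)) P
  fixedPoint : IdentDistrib X (fun ω => A ω + ∑ i ∈ Finset.range (X ω), B i ω) P P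

end

end HeavyTail

open HeavyTail

namespace HeavyTail

/-! ### Asymptotic comparisons in epsilon form -/

/-! Write `F x = P(X > x)` and `S_n = A + B_0 + ... + B_{n-1}` (`stepSum`). Conditioning on `X`
gives `F x = E[P(S_n > x)]` at `n = X`, and this mean is split at `X = d x`.

Where `X ≤ d x`, one big jump governs: for fixed `n`, `P(S_n > x)` is asymptotically `(c₁ + n c₂)
tail G x`, since exactly one summand is responsible. Averaging over `X` gives `(c₁ + E X * c₂) tail
G x`, and `E X = a / (1 - b)` makes the constant `D`. From below a Fatou argument suffices
(`eventually_le_integral_ite`). From above a dominating function is needed, namely `P(S_n > x) ≤ C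
(1 + n) tail G x` uniformly over `n ≤ d x` with `d b < 1`; it comes from a Chernoff bound for
truncated sums combined with dominated variation (`exists_measureReal_lt_sum_le`). Both need `E X <
∞`, obtained by iterating the equation on truncated variables (`integrable_X`).

Where `X > d x`, the law of large numbers decides: if `d b > 1`, the sum exceeds `x` with
probability at least `1 - C / x`; if `d b < 1`, the trivial bound `1` is used. Hence `F x ≤ (D + ε)
tail G x + F (d x)` for `1 < d < 1 / b`, and `F x ≥ (D - ε) tail G x + (1 - C / x) F (d x)` for `d >
1 / b`, for large `x`. Iterating along `x, d x, d² x, ...` produces `D * T_d x`; the factors `1 - C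
/ (d ^ n x)` have a product close to `1`.

Exact asymptotics follow by letting `d → 1 / b` whenever `T_d` varies continuously there up to a
factor near `1`. Extended regular variation implies this (`HasERVBounds.exists_geomTailSum_le`), and
scaling bounds pass termwise from `G` to `T_c` and then to `F`. Under regular variation `T_{1/b} x /
tail G x` tends to a geometric series. -/

theorem ratioLimsup_le_iff {f g : ℝ → ℝ} (hg : ∀ᶠ x in atTop, 0 < g x) (r : ℝ) :
    ratioLimsup f g ≤ (r : EReal) ↔ ∀ ε > 0, ∀ᶠ x in atTop, f x ≤ (r + ε) * g x := by
  constructor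
  · intro h ε hε
    have hlt : ratioLimsup f g < ((r + ε : ℝ) : EReal) :=
      h.trans_lt (EReal.coe_lt_coe_iff.2 (by linarith))
    filter_upwards [eventually_lt_of_limsup_lt hlt, hg] with x hx hgx
    exact (div_le_iff₀ hgx).1 (EReal.coe_lt_coe_iff.1 hx).le
  · intro h
    refine EReal.le_of_forall_lt_iff_le.1 fun z hz => ?_
    have hz' : 0 < z - r := sub_pos.2 (EReal.coe_lt_coe_iff.1 hz)
    refine limsup_le_of_le (h := ?_)
    filter_upwards [h _ hz', hg] with x hx hgx
    exact EReal.coe_le_coe_iff.2 ((div_le_iff₀ hgx).2 (by simpa using hx))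

theorem le_ratioLiminf_iff {f g : ℝ → ℝ} (hg : ∀ᶠ x in atTop, 0 < g x) (r : ℝ) :
    (r : EReal) ≤ ratioLiminf f g ↔ ∀ ε > 0, ∀ᶠ x in atTop, (r - ε) * g x ≤ f x := by
  constructor
  · intro h ε hε
    have hlt : ((r - ε : ℝ) : EReal) < ratioLiminf f g :=
      (EReal.coe_lt_coe_iff.2 (by linarith)).trans_le h
    filter_upwards [eventually_lt_of_lt_liminf hlt, hg] with x hx hgx
    exact (le_div_iff₀ hgx).1 (EReal.coe_lt_coe_iff.1 hx).le
  · intro h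
    refine EReal.ge_of_forall_gt_iff_ge.1 fun z hz => ?_
    have hz' : 0 < r - z := sub_pos.2 (EReal.coe_lt_coe_iff.1 hz)
    refine le_liminf_of_le (h := ?_)
    filter_upwards [h _ hz', hg] with x hx hgx
    exact EReal.coe_le_coe_iff.2 ((le_div_iff₀ hgx).2 (by simpa using hx))

theorem tendsto_div_iff_forall_eps {f g : ℝ → ℝ} (hg : ∀ᶠ x in atTop, 0 < g x) (r : ℝ) :
    Tendsto (fun x => f x / g x) atTop (𝓝 r) ↔
      (∀ ε > 0, ∀ᶠ x in atTop, (r - ε) * g x ≤ f x) ∧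
      (∀ ε > 0, ∀ᶠ x in atTop, f x ≤ (r + ε) * g x) := by
  constructor
  · intro h
    refine ⟨fun ε hε => ?_, fun ε hε => ?_⟩
    · filter_upwards [h.eventually (lt_mem_nhds (sub_lt_self r hε)), hg] with x hx hgx
      exact (le_div_iff₀ hgx).1 hx.le
    · filter_upwards [h.eventually (gt_mem_nhds (lt_add_of_pos_right r hε)), hg] with x hx hgx
      exact (div_le_iff₀ hgx).1 hx.le
  · rintro ⟨hl, hu⟩
    refine tendsto_order.2 ⟨fun z hz => ?_, fun z hz => ?_⟩
    · filter_upwards [hl ((r - z) / 2) (by linarith), hg] with x hx hgx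
      exact lt_of_lt_of_le (by linarith) ((le_div_iff₀ hgx).2 hx)
    · filter_upwards [hu ((z - r) / 2) (by linarith), hg] with x hx hgx
      exact lt_of_le_of_lt ((div_le_iff₀ hgx).2 hx) (by linarith)

/-! ### Tails of distributions -/

theorem tail_nonneg (G : Measure ℝ) (x : ℝ) : 0 ≤ tail G x := measureReal_nonneg

section Tail

variable {G : Measure ℝ} [IsProbabilityMeasure G]

theorem tail_le_one (x : ℝ) : tail G x ≤ 1 := measureReal_le_one

theorem tail_antitone : Antitone (tail G) := fun _ _ h =>
  measureReal_mono (Set.Ioi_subset_Ioi h)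

theorem tendsto_tail_atTop : Tendsto (tail G) atTop (𝓝 0) := by
  have h : tail G = fun x => 1 - cdf G x := by
    ext x
    rw [cdf_eq_real, tail, ← Set.compl_Iic, probReal_compl_eq_one_sub measurableSet_Iic]
  rw [h]
  simpa using (tendsto_const_nhds (x := (1 : ℝ))).sub (tendsto_cdf_atTop G)

theorem IsDominantlyVarying.exists_tail_le (hD : IsDominantlyVarying G)
    (hpos : ∀ x, 0 < tail G x) :
    ∃ y M : ℝ, 1 < y ∧ 1 ≤ M ∧ ∀ x, 0 ≤ x → tail G x ≤ M * tail G (y * x) := by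
  obtain ⟨y, hy, h⟩ := hD
  obtain ⟨δ, hδ, hδ'⟩ := EReal.lt_iff_exists_real_btwn.1 h
  have hδ0 : 0 < δ := by exact_mod_cast hδ
  obtain ⟨x₀, hx₀⟩ := eventually_atTop.1 (eventually_lt_of_lt_liminf hδ')
  -- Beyond `x₀` the factor `δ⁻¹` works; on `[0, x₀]` the left side is at most `1` and `tail G (y *
  -- x) ≥ tail G (y * x₀) > 0`.
  refine ⟨y, max 1 (max δ⁻¹ (tail G (y * x₀))⁻¹), hy, le_max_left _ _, fun x hx => ?_⟩
  rcases le_total x₀ x with h0 | h0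
  · have h1 : δ < tail G (y * x) / tail G x := EReal.coe_lt_coe_iff.1 (hx₀ x h0)
    rw [lt_div_iff₀ (hpos x)] at h1
    calc tail G x = δ⁻¹ * (δ * tail G x) := by field_simp
      _ ≤ δ⁻¹ * tail G (y * x) := by gcongr
      _ ≤ _ := by
        gcongr
        · exact tail_nonneg _ _
        · exact (le_max_left _ _).trans (le_max_right _ _)
  · have h1 : tail G (y * x₀) ≤ tail G (y * x) := tail_antitone (by gcongr)
    calc tail G x ≤ 1 := tail_le_one x
      _ = (tail G (y * x₀))⁻¹ * tail G (y * x₀) := (inv_mul_cancel₀ (hpos _).ne').symm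
      _ ≤ (tail G (y * x₀))⁻¹ * tail G (y * x) := by
        gcongr
        exact inv_nonneg.2 (tail_nonneg _ _)
      _ ≤ _ := by
        gcongr
        · exact tail_nonneg _ _
        · exact (le_max_right _ _).trans (le_max_right _ _)

/-- A dominantly varying tail is controlled polynomially under scaling. -/
theorem IsDominantlyVarying.exists_tail_mul_le (hD : IsDominantlyVarying G)
    (hpos : ∀ x, 0 < tail G x) :
    ∃ (C : ℝ) (k : ℕ), 1 ≤ C ∧ ∀ x t : ℝ, 0 ≤ x → 0 < t →
      tail G (t * x) ≤ C * (1 + 1 / t) ^ k * tail G x := by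
  obtain ⟨y, M, hy, hM, h⟩ := hD.exists_tail_le hpos
  have hy0 : 0 < y := one_pos.trans hy
  -- With `M < y ^ k`, a loss `M ^ (n + 1)` over `n + 1` scalings is at most `(y ^ (n + 1)) ^ k`;
  -- for `y ^ n ≤ 1 / t` this is polynomial in `1 / t`.
  obtain ⟨k, hk⟩ := pow_unbounded_of_one_lt M hy
  have hiter : ∀ (j : ℕ) (x : ℝ), 0 ≤ x → tail G x ≤ M ^ j * tail G (y ^ j * x) := by
    intro j
    induction j with
    | zero => intro x _; simp
    | succ j ih =>
      intro x hx
      calc tail G x ≤ M ^ j * tail G (y ^ j * x) := ih x hx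
        _ ≤ M ^ j * (M * tail G (y * (y ^ j * x))) := by
          gcongr
          exact h _ (by positivity)
        _ = M ^ (j + 1) * tail G (y ^ (j + 1) * x) := by
          rw [← mul_assoc, ← pow_succ, ← mul_assoc y, ← pow_succ']
  refine ⟨y ^ k, k, one_le_pow₀ hy.le, fun x t hx ht => ?_⟩
  have hone : 1 ≤ y ^ k := one_le_pow₀ hy.le
  rcases le_total 1 t with h1 | h1
  · have h2 : (1 : ℝ) ≤ (1 + 1 / t) ^ k := one_le_pow₀ (by simp [ht.le])
    calc tail G (t * x) ≤ tail G x := tail_antitone (le_mul_of_one_le_left hx h1)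
      _ = 1 * 1 * tail G x := by ring
      _ ≤ _ := by
        gcongr
        exact tail_nonneg _ _
  · obtain ⟨n, hn, hn'⟩ := exists_nat_pow_near (one_le_one_div ht h1) hy
    have h3 : 1 ≤ y ^ (n + 1) * t := by
      rw [div_lt_iff₀ ht] at hn'
      exact hn'.le
    have h4 : M ^ (n + 1) ≤ y ^ k * (1 + 1 / t) ^ k := by
      calc M ^ (n + 1) ≤ (y ^ k) ^ (n + 1) := by gcongr
        _ = (y * y ^ n) ^ k := by rw [← pow_mul, mul_comm, pow_mul, ← pow_succ']
        _ ≤ (y * (1 + 1 / t)) ^ k := by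
          gcongr
          linarith
        _ = _ := mul_pow _ _ _
    calc tail G (t * x) ≤ M ^ (n + 1) * tail G (y ^ (n + 1) * (t * x)) :=
          hiter _ _ (by positivity)
      _ ≤ M ^ (n + 1) * tail G x := by
        gcongr
        apply tail_antitone
        rw [← mul_assoc]
        exact le_mul_of_one_le_left hx h3
      _ ≤ _ := by
        gcongr
        exact tail_nonneg _ _

end Tail

/-! ### Asymptotic tail bounds for sums of independent random variables -/

section Sums

variable {Ω : Type*} [MeasurableSpace Ω]

/-- `limsup P(U > x) / G((x, ∞)) ≤ u`. -/
def TailLimsupLE (P : Measure Ω) (G : Measure ℝ) (U : Ω → ℝ) (u : ℝ) : Prop :=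
  ∀ ε > 0, ∀ᶠ x in atTop, P.real {ω | x < U ω} ≤ (u + ε) * tail G x

/-- `liminf P(U > x) / G((x, ∞)) ≥ u`. -/
def TailLiminfGE (P : Measure Ω) (G : Measure ℝ) (U : Ω → ℝ) (u : ℝ) : Prop :=
  ∀ ε > 0, ∀ᶠ x in atTop, (u - ε) * tail G x ≤ P.real {ω | x < U ω}

theorem tail_map {P : Measure Ω} {U : Ω → ℝ} (hU : Measurable U) (x : ℝ) :
    tail (P.map U) x = P.real {ω | x < U ω} := by
  rw [tail, map_measureReal_apply hU measurableSet_Ioi]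
  rfl

theorem indepFun_measureReal_inter {P : Measure Ω} {U V : Ω → ℝ} (h : IndepFun U V P) (x y : ℝ) :
    P.real {ω | x < U ω ∧ y < V ω} = P.real {ω | x < U ω} * P.real {ω | y < V ω} := by
  have h1 := h.measure_inter_preimage_eq_mul (Set.Ioi x) (Set.Ioi y) measurableSet_Ioi
    measurableSet_Ioi
  simp only [Measure.real, ← ENNReal.toReal_mul]
  exact congrArg ENNReal.toReal h1

variable {P : Measure Ω} [IsProbabilityMeasure P] {G : Measure ℝ}

theorem tendsto_measureReal_lt_atTop {U : Ω → ℝ} (hU : Measurable U) :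
    Tendsto (fun x => P.real {ω | x < U ω}) atTop (𝓝 0) := by
  have := Measure.isProbabilityMeasure_map (μ := P) hU.aemeasurable
  exact (tendsto_tail_atTop (G := P.map U)).congr (tail_map hU)

/-- Inclusion-exclusion: the sum exceeds `x` as soon as one nonnegative summand does, and by
independence the overlap is the product `p * q`, negligible because `p → 0`. -/
theorem TailLiminfGE.add {U V : Ω → ℝ} (hU : Measurable U) (hV : Measurable V)
    (hU0 : ∀ ω, 0 ≤ U ω) (hV0 : ∀ ω, 0 ≤ V ω) (hUV : IndepFun U V P) {u v : ℝ} (hv : 0 ≤ v)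
    (hu' : TailLiminfGE P G U u) (hv' : TailLiminfGE P G V v) :
    TailLiminfGE P G (fun ω => U ω + V ω) (u + v) := by
  intro ε hε
  have hδ : 0 < min 1 (ε / 4 / (v + 1)) := by positivity
  filter_upwards [hu' (ε / 4) (by positivity), hv' (ε / 4) (by positivity),
    (tendsto_measureReal_lt_atTop (P := P) hU).eventually (gt_mem_nhds hδ)] with x h1 h2 h3
  have hle : P.real {ω | x < U ω} + P.real {ω | x < V ω} -
      P.real {ω | x < U ω} * P.real {ω | x < V ω} ≤ P.real {ω | x < U ω + V ω} := by
    have h4 := measureReal_union_add_inter (μ := P) (s := {ω | x < U ω}) (t := {ω | x < V ω})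
      (hV measurableSet_Ioi)
    have h5 := indepFun_measureReal_inter hUV x x
    have h6 : P.real ({ω | x < U ω} ∪ {ω | x < V ω}) ≤ P.real {ω | x < U ω + V ω} := by
      refine measureReal_mono ?_
      rintro ω (h | h)
      · exact lt_of_lt_of_le h (le_add_of_nonneg_right (hV0 ω))
      · exact lt_of_lt_of_le h (le_add_of_nonneg_left (hU0 ω))
    have h7 : P.real ({ω | x < U ω} ∩ {ω | x < V ω}) = P.real {ω | x < U ω ∧ x < V ω} := rfl
    linarith
  have hG := tail_nonneg G x
  have hp0 : 0 ≤ P.real {ω | x < U ω} := measureReal_nonneg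
  have hq0 : 0 ≤ P.real {ω | x < V ω} := measureReal_nonneg
  set p := P.real {ω | x < U ω}
  set q := P.real {ω | x < V ω}
  have hp1 : p ≤ 1 := h3.le.trans (min_le_left _ _)
  have hp2 : p * (v + 1) ≤ ε / 4 := by
    rw [← le_div_iff₀ (by positivity)]
    exact h3.le.trans (min_le_right _ _)
  have h8 : (v - ε / 4) * (1 - p) * tail G x ≤ q * (1 - p) := by
    calc _ = (v - ε / 4) * tail G x * (1 - p) := by ring
      _ ≤ _ := by
        gcongr
  have h9 : (v - ε / 2) * tail G x ≤ (v - ε / 4) * (1 - p) * tail G x := by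
    gcongr
    nlinarith
  nlinarith

/-- One big jump. If `U + V > x`, then either one variable exceeds `x - K`, or one exceeds `x / 2`
while the other exceeds `K`. Long-tailedness absorbs the shift by `K` in the first case; in the
second, `hhalf` bounds the tail at `x / 2` and the factor `P(· > K)` is small by the choice of `K`.
-/
theorem TailLimsupLE.add (hL : IsLongTailed G) (hpos : ∀ x, 0 < tail G x) {C : ℝ} (hC : 1 ≤ C)
    (hhalf : ∀ x, 0 ≤ x → tail G (x / 2) ≤ C * tail G x)
    {U V : Ω → ℝ} (hU : Measurable U) (hV : Measurable V)
    (hUV : IndepFun U V P) {u v : ℝ} (hu : 0 ≤ u) (hv : 0 ≤ v)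
    (hu' : TailLimsupLE P G U u) (hv' : TailLimsupLE P G V v) :
    TailLimsupLE P G (fun ω => U ω + V ω) (u + v) := by
  intro ε hε
  obtain ⟨K, hK1, hK2⟩ : ∃ K, P.real {ω | K < U ω} * ((v + 1) * C) ≤ ε / 8 ∧
      P.real {ω | K < V ω} * ((u + 1) * C) ≤ ε / 8 := by
    have h1 : 0 < ε / 8 / ((v + 1) * C) := by positivity
    have h2 : 0 < ε / 8 / ((u + 1) * C) := by positivity
    obtain ⟨K, h3, h4⟩ := (((tendsto_measureReal_lt_atTop (P := P) hU).eventually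
      (gt_mem_nhds h1)).and ((tendsto_measureReal_lt_atTop (P := P) hV).eventually
      (gt_mem_nhds h2))).exists
    exact ⟨K, (le_div_iff₀ (by positivity)).1 h3.le, (le_div_iff₀ (by positivity)).1 h4.le⟩
  have hshift : ∀ w, 0 ≤ w → ∀ᶠ x in atTop,
      (w + ε / 8) * tail G (x - K) ≤ (w + ε / 4) * tail G x := by
    intro w hw
    have h1 : 1 < (w + ε / 4) / (w + ε / 8) := by
      rw [one_lt_div (by positivity)]
      linarith
    filter_upwards [(hL (-K)).eventually (gt_mem_nhds h1)] with x hx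
    rw [div_lt_iff₀ (hpos x), ← sub_eq_add_neg] at hx
    calc _ ≤ (w + ε / 8) * ((w + ε / 4) / (w + ε / 8) * tail G x) := by gcongr
      _ = _ := by field_simp
  have hsub : Tendsto (fun x : ℝ => x - K) atTop atTop := tendsto_atTop_add_const_right _ (-K)
    tendsto_id
  have hdiv : Tendsto (fun x : ℝ => x / 2) atTop atTop := tendsto_id.atTop_div_const two_pos
  filter_upwards [hsub.eventually (hu' (ε / 8) (by positivity)),
    hsub.eventually (hv' (ε / 8) (by positivity)), hdiv.eventually (hu' 1 one_pos),
    hdiv.eventually (hv' 1 one_pos), hshift u hu, hshift v hv, eventually_ge_atTop 0]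
    with x h1 h2 h3 h4 h5 h6 hx
  have hcover : {ω | x < U ω + V ω} ⊆ ({ω | x - K < U ω} ∪ {ω | x - K < V ω}) ∪
      ({ω | K < U ω ∧ x / 2 < V ω} ∪ {ω | x / 2 < U ω ∧ K < V ω}) := by
    intro ω (hω : x < U ω + V ω)
    simp only [Set.mem_union, Set.mem_ofPred_eq]
    by_contra! hcon
    obtain ⟨⟨h7, h8⟩, h9, h10⟩ := hcon
    have h11 : K < U ω := by linarith
    have h12 : K < V ω := by linarith
    have h13 := h9 h11
    by_cases h14 : x / 2 < U ω
    · linarith [h10 h14]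
    · linarith
  have hle := (measureReal_mono hcover (measure_ne_top P _)).trans
    ((measureReal_union_le _ _).trans
      (add_le_add (measureReal_union_le _ _) (measureReal_union_le _ _)))
  rw [indepFun_measureReal_inter hUV, indepFun_measureReal_inter hUV] at hle
  have hG := tail_nonneg G x
  have h7 : P.real {ω | K < U ω} * P.real {ω | x / 2 < V ω} ≤ ε / 8 * tail G x := by
    calc _ ≤ P.real {ω | K < U ω} * ((v + 1) * (C * tail G x)) := by
          gcongr
          exact h4.trans (by gcongr; exact hhalf x hx)
      _ = P.real {ω | K < U ω} * ((v + 1) * C) * tail G x := by ring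
      _ ≤ _ := by gcongr
  have h8 : P.real {ω | x / 2 < U ω} * P.real {ω | K < V ω} ≤ ε / 8 * tail G x := by
    calc _ ≤ ((u + 1) * (C * tail G x)) * P.real {ω | K < V ω} := by
          gcongr
          exact h3.trans (by gcongr; exact hhalf x hx)
      _ = P.real {ω | K < V ω} * ((u + 1) * C) * tail G x := by ring
      _ ≤ _ := by gcongr
  nlinarith

end Sums

/-! ### Large deviation bounds for sums of nonnegative i.i.d. random variables -/

section LargeDeviations

variable {Ω : Type*} [MeasurableSpace Ω] {P : Measure Ω} {Y : ℕ → Ω → ℝ}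

theorem mgf_sum_comp_of_iid (hmeas : ∀ i, Measurable (Y i)) (hind : iIndepFun Y P)
    (hid : ∀ i, IdentDistrib (Y i) (Y 0) P P) {f : ℝ → ℝ} (hf : Measurable f) (n : ℕ) (t : ℝ) :
    mgf (fun ω => ∑ i ∈ Finset.range n, f (Y i ω)) P t = mgf (fun ω => f (Y 0 ω)) P t ^ n := by
  have h1 := (hind.comp (fun _ => f) (fun _ => hf)).mgf_sum (t := t)
    (fun i => hf.comp (hmeas i)) (Finset.range n)
  have h2 : ∀ i, mgf (f ∘ Y i) P t = mgf (f ∘ Y 0) P t := fun i =>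
    (((hid i).comp hf).comp (u := fun y => Real.exp (t * y)) (by fun_prop)).integral_eq
  have h3 : (∑ i ∈ Finset.range n, f ∘ Y i) = fun ω => ∑ i ∈ Finset.range n, f (Y i ω) := by
    ext ω
    simp
  rw [h3] at h1
  rw [h1, Finset.prod_congr rfl (fun i _ => h2 i)]
  simp [Function.comp_def]

variable [IsProbabilityMeasure P]

theorem integrable_of_abs_le {f : Ω → ℝ} (hf : Measurable f) (C : ℝ) (h : ∀ ω, |f ω| ≤ C) :
    Integrable f P :=
  Integrable.of_bound hf.aestronglyMeasurable C (ae_of_all _ h)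

theorem integrable_exp_of_abs_le {f : Ω → ℝ} (hf : Measurable f) (C : ℝ) (h : ∀ ω, |f ω| ≤ C)
    (t : ℝ) : Integrable (fun ω => Real.exp (t * f ω)) P := by
  refine integrable_of_abs_le (by fun_prop) (Real.exp (|t| * C)) fun ω => ?_
  rw [Real.abs_exp, Real.exp_le_exp]
  exact (le_abs_self _).trans (by rw [abs_mul]; gcongr; exact h ω)

/-- The lower large deviations of a random walk with nonnegative steps decay summably along
geometric sequences. -/
theorem exists_measureReal_sum_le_le (hmeas : ∀ i, Measurable (Y i)) (hind : iIndepFun Y P)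
    (hid : ∀ i, IdentDistrib (Y i) (Y 0) P P) (hnn : ∀ i ω, 0 ≤ Y i ω)
    (hint : Integrable (Y 0) P) {m : ℝ} (hm : m < ∫ ω, Y 0 ω ∂P) :
    ∃ C > 0, ∀ n : ℕ, 0 < n →
      P.real {ω | ∑ i ∈ Finset.range n, Y i ω ≤ n * m} ≤ C / n := by
  -- Truncating at a large `M` only lowers the sum and keeps the mean `β` above `m`; Chernoff then
  -- applies to bounded steps.
  have hlim : Tendsto (fun M : ℕ => ∫ ω, min (Y 0 ω) M ∂P) atTop (𝓝 (∫ ω, Y 0 ω ∂P)) := by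
    refine tendsto_integral_of_dominated_convergence (Y 0)
      (fun M => ((hmeas 0).min measurable_const).aestronglyMeasurable) hint
      (fun M => ae_of_all _ fun ω => ?_) (ae_of_all _ fun ω => ?_)
    · rw [Real.norm_of_nonneg (le_min (hnn 0 ω) (Nat.cast_nonneg M))]
      exact min_le_left _ _
    · refine tendsto_const_nhds.congr' ?_
      obtain ⟨N, hN⟩ := exists_nat_ge (Y 0 ω)
      filter_upwards [eventually_ge_atTop N] with M hM
      exact (min_eq_left (hN.trans (by exact_mod_cast hM))).symm
  obtain ⟨M, hM, hM0⟩ := ((hlim.eventually (lt_mem_nhds hm)).and (eventually_gt_atTop 0)).exists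
  have hM0' : (0 : ℝ) < M := by exact_mod_cast hM0
  set β := ∫ ω, min (Y 0 ω) M ∂P
  have hf : Measurable fun y : ℝ => min y (M : ℝ) := measurable_id.min measurable_const
  have habs : ∀ i ω, |min (Y i ω) M| ≤ M := fun i ω => by
    rw [abs_of_nonneg (le_min (hnn i ω) hM0'.le)]
    exact min_le_right _ _
  have hintM : Integrable (fun ω => min (Y 0 ω) M) P :=
    integrable_of_abs_le (hf.comp (hmeas 0)) M (habs 0)
  -- With `s` this small, the quadratic error `s² M²` costs at most half of the linear gain `s (β -
  -- m)`.
  obtain ⟨s, hs0, hs1, hs2⟩ : ∃ s : ℝ, 0 < s ∧ s * M ≤ 1 ∧ s * M ^ 2 ≤ (β - m) / 2 := by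
    refine ⟨min (1 / M) ((β - m) / 2 / M ^ 2), ?_, ?_, ?_⟩
    · have : 0 < β - m := by linarith
      positivity
    · rw [← le_div_iff₀ hM0']
      exact min_le_left _ _
    · rw [← le_div_iff₀ (by positivity)]
      exact min_le_right _ _
  have hmgf : mgf (fun ω => min (Y 0 ω) M) P (-s) ≤ Real.exp (-s * β + s ^ 2 * M ^ 2) := by
    have h1 : ∀ ω, Real.exp (-s * min (Y 0 ω) M) ≤
        1 + -s * min (Y 0 ω) M + s ^ 2 * M ^ 2 := by
      intro ω
      have h2 : |-s * min (Y 0 ω) M| ≤ s * M := by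
        rw [abs_mul, abs_neg, abs_of_pos hs0]
        exact mul_le_mul_of_nonneg_left (habs 0 ω) hs0.le
      have h3 := (abs_le.1 (Real.abs_exp_sub_one_sub_id_le (h2.trans hs1))).2
      have h4 : (-s * min (Y 0 ω) M) ^ 2 ≤ (s * M) ^ 2 := by
        rw [← sq_abs]
        gcongr
      nlinarith
    have hint1 : Integrable (fun ω => 1 + -s * min (Y 0 ω) M) P :=
      (integrable_const _).add (hintM.const_mul _)
    calc mgf (fun ω => min (Y 0 ω) M) P (-s)
        ≤ ∫ ω, (1 + -s * min (Y 0 ω) M + s ^ 2 * M ^ 2) ∂P :=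
          integral_mono (integrable_exp_of_abs_le (hf.comp (hmeas 0)) M (habs 0) _)
            (hint1.add (integrable_const _)) h1
      _ = (-s * β + s ^ 2 * M ^ 2) + 1 := by
          rw [integral_add hint1 (integrable_const _), integral_add (integrable_const _) (hintM.const_mul _), integral_const_mul]
          simp only [integral_const, probReal_univ, one_smul]
          ring
      _ ≤ _ := Real.add_one_le_exp _
  have hg : 0 < s * (β - m) / 2 := by
    have : 0 < β - m := by linarith
    positivity
  refine ⟨1 / (s * (β - m) / 2), by positivity, fun n hn => ?_⟩
  have hn' : (0 : ℝ) < n := by exact_mod_cast hn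
  have hsum_meas : Measurable fun ω => ∑ i ∈ Finset.range n, min (Y i ω) (M : ℝ) :=
    Finset.measurable_sum _ fun i _ => hf.comp (hmeas i)
  have hsum_abs : ∀ ω, |∑ i ∈ Finset.range n, min (Y i ω) (M : ℝ)| ≤ n * M := fun ω =>
    (Finset.abs_sum_le_sum_abs _ _).trans
      ((Finset.sum_le_sum fun i _ => habs i ω).trans (by simp))
  calc P.real {ω | ∑ i ∈ Finset.range n, Y i ω ≤ n * m}
      ≤ P.real {ω | ∑ i ∈ Finset.range n, min (Y i ω) (M : ℝ) ≤ n * m} := by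
        refine measureReal_mono fun ω hω => ?_
        rw [Set.mem_ofPred_eq] at hω ⊢
        exact (Finset.sum_le_sum fun i _ => min_le_left _ _).trans hω
    _ ≤ Real.exp (-(-s) * (n * m)) *
        mgf (fun ω => ∑ i ∈ Finset.range n, min (Y i ω) (M : ℝ)) P (-s) :=
        measure_le_le_exp_mul_mgf _ (by linarith)
          (integrable_exp_of_abs_le hsum_meas _ hsum_abs _)
    _ ≤ Real.exp (-(-s) * (n * m)) * Real.exp (-s * β + s ^ 2 * M ^ 2) ^ n := by
        rw [mgf_sum_comp_of_iid hmeas hind hid hf]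
        gcongr
        exact mgf_nonneg
    _ = Real.exp (n * (-s * (β - m) + s * (s * M ^ 2))) := by
        rw [← Real.exp_nat_mul, ← Real.exp_add]
        ring_nf
    _ ≤ Real.exp (-(n * (s * (β - m) / 2))) := by
        rw [Real.exp_le_exp]
        have := mul_le_mul_of_nonneg_left hs2 hs0.le
        nlinarith
    -- The exponential rate is weakened by `exp (-v) ≤ 1 / v`; order `1 / n` is all that the
    -- iteration requires.
    _ ≤ (n * (s * (β - m) / 2))⁻¹ := by
        rw [Real.exp_neg]
        gcongr
        linarith [Real.add_one_le_exp (n * (s * (β - m) / 2))]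
    _ = _ := by
        field_simp

/-- A Chernoff bound for sums of truncated nonnegative random variables. -/
theorem measureReal_lt_sum_le (hmeas : ∀ i, Measurable (Y i)) (hind : iIndepFun Y P)
    (hid : ∀ i, IdentDistrib (Y i) (Y 0) P P) (hnn : ∀ i ω, 0 ≤ Y i ω)
    (hint : Integrable (Y 0) P) {s T : ℝ} (hs : 0 ≤ s) (hT : 0 ≤ T) (R y : ℝ) (n : ℕ) :
    P.real {ω | y < ∑ i ∈ Finset.range n, Y i ω} ≤ n * P.real {ω | T < Y 0 ω} +
      Real.exp (n * (s * (∫ ω, Y 0 ω ∂P) * Real.exp (s * R) +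
        Real.exp (s * T) * P.real {ω | R < Y 0 ω}) - s * y) := by
  have hf : Measurable fun y : ℝ => min y T := measurable_id.min measurable_const
  have habs : ∀ i ω, |min (Y i ω) T| ≤ T := fun i ω => by
    rw [abs_of_nonneg (le_min (hnn i ω) hT)]
    exact min_le_right _ _
  have hsum_meas : Measurable fun ω => ∑ i ∈ Finset.range n, min (Y i ω) T :=
    Finset.measurable_sum _ fun i _ => hf.comp (hmeas i)
  have hsum_abs : ∀ ω, |∑ i ∈ Finset.range n, min (Y i ω) T| ≤ n * T := fun ω =>
    (Finset.abs_sum_le_sum_abs _ _).trans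
      ((Finset.sum_le_sum fun i _ => habs i ω).trans (by simp))
  have hR : MeasurableSet {ω | R < Y 0 ω} := hmeas 0 measurableSet_Ioi
  have hmgf : mgf (fun ω => min (Y 0 ω) T) P s ≤
      Real.exp (s * (∫ ω, Y 0 ω ∂P) * Real.exp (s * R) +
        Real.exp (s * T) * P.real {ω | R < Y 0 ω}) := by
    -- Second truncation level `R`: on `Y ≤ R` the inequality `exp v ≤ 1 + v exp v` is used with
    -- `exp v ≤ exp (s R)`; on `Y > R` the exponential is at most `exp (s T)`.
    have h1 : ∀ ω, Real.exp (s * min (Y 0 ω) T) ≤ 1 + s * Real.exp (s * R) * Y 0 ω +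
        {ω | R < Y 0 ω}.indicator (fun _ => Real.exp (s * T)) ω := by
      intro ω
      by_cases h : R < Y 0 ω
      · rw [Set.indicator_of_mem (show ω ∈ {ω | R < Y 0 ω} from h)]
        have h2 : Real.exp (s * min (Y 0 ω) T) ≤ Real.exp (s * T) := by
          gcongr
          exact min_le_right _ _
        have h3 : 0 ≤ s * Real.exp (s * R) * Y 0 ω :=
          mul_nonneg (mul_nonneg hs (Real.exp_pos _).le) (hnn 0 ω)
        linarith
      · rw [Set.indicator_of_notMem (show ω ∉ {ω | R < Y 0 ω} from h), add_zero]
        have h2 : Real.exp (s * min (Y 0 ω) T) ≤ Real.exp (s * Y 0 ω) := by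
          gcongr
          exact min_le_left _ _
        have h3 : Real.exp (s * Y 0 ω) ≤ 1 + s * Y 0 ω * Real.exp (s * Y 0 ω) := by
          have h4 := Real.add_one_le_exp (-(s * Y 0 ω))
          have h5 := Real.exp_pos (s * Y 0 ω)
          have h6 : Real.exp (s * Y 0 ω) * Real.exp (-(s * Y 0 ω)) = 1 := by
            rw [← Real.exp_add]
            simp
          nlinarith
        have h7 : s * Y 0 ω * Real.exp (s * Y 0 ω) ≤ s * Y 0 ω * Real.exp (s * R) := by
          have h8 := hnn 0 ω
          gcongr
          exact not_lt.1 h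
        linarith
    have hint1 : Integrable (fun ω => 1 + s * Real.exp (s * R) * Y 0 ω) P :=
      (integrable_const _).add (hint.const_mul _)
    have hint2 : Integrable ({ω | R < Y 0 ω}.indicator (fun _ => Real.exp (s * T))) P :=
      (integrable_const _).indicator hR
    calc mgf (fun ω => min (Y 0 ω) T) P s
        ≤ ∫ ω, (1 + s * Real.exp (s * R) * Y 0 ω +
            {ω | R < Y 0 ω}.indicator (fun _ => Real.exp (s * T)) ω) ∂P :=
          integral_mono (integrable_exp_of_abs_le (hf.comp (hmeas 0)) T (habs 0) _)
            (hint1.add hint2) h1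
      _ = (s * (∫ ω, Y 0 ω ∂P) * Real.exp (s * R) +
            Real.exp (s * T) * P.real {ω | R < Y 0 ω}) + 1 := by
          rw [integral_add hint1 hint2, integral_add (integrable_const _) (hint.const_mul _),
            integral_const_mul, integral_indicator hR]
          simp only [integral_const, probReal_univ, smul_eq_mul, measureReal_restrict_apply_univ]
          ring
      _ ≤ _ := Real.add_one_le_exp _
  -- Either some step exceeds `T`, or truncation changes nothing.
  have hcover : {ω | y < ∑ i ∈ Finset.range n, Y i ω} ⊆
      (⋃ i ∈ Finset.range n, {ω | T < Y i ω}) ∪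
        {ω | y ≤ ∑ i ∈ Finset.range n, min (Y i ω) T} := by
    intro ω (hω : y < _)
    by_cases h : ∃ i ∈ Finset.range n, T < Y i ω
    · left
      simpa using h
    · right
      push Not at h
      change y ≤ _
      rw [Finset.sum_congr rfl fun i hi => min_eq_left (h i hi)]
      exact hω.le
  have hunion : P.real (⋃ i ∈ Finset.range n, {ω | T < Y i ω}) ≤ n * P.real {ω | T < Y 0 ω} := by
    refine (measureReal_biUnion_finset_le _ _).trans ?_
    have h1 : ∀ i, P.real {ω | T < Y i ω} = P.real {ω | T < Y 0 ω} := fun i =>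
      congrArg ENNReal.toReal ((hid i).measure_mem_eq measurableSet_Ioi)
    simp [h1]
  refine (measureReal_mono hcover).trans ((measureReal_union_le _ _).trans
    (add_le_add hunion ?_))
  calc P.real {ω | y ≤ ∑ i ∈ Finset.range n, min (Y i ω) T}
      ≤ Real.exp (-s * y) * mgf (fun ω => ∑ i ∈ Finset.range n, min (Y i ω) T) P s :=
        measure_ge_le_exp_mul_mgf _ hs (integrable_exp_of_abs_le hsum_meas _ hsum_abs _)
    _ ≤ Real.exp (-s * y) * Real.exp (s * (∫ ω, Y 0 ω ∂P) * Real.exp (s * R) +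
        Real.exp (s * T) * P.real {ω | R < Y 0 ω}) ^ n := by
        rw [mgf_sum_comp_of_iid hmeas hind hid hf]
        gcongr
        exact mgf_nonneg
    _ = _ := by
        rw [← Real.exp_nat_mul, ← Real.exp_add]
        ring_nf

/-- Absorbs the polynomial loss of dominated variation into half of an exponential. The exponent is
shared among `k + 1` factors rather than `k`, so that `k = 0` causes no division by zero. -/
theorem exists_one_add_mul_pow_le (c : ℝ) (hc : 0 ≤ c) (k : ℕ) :
    ∃ C > 0, ∀ u : ℝ, 0 ≤ u → (1 + c * u) ^ k ≤ C * Real.exp (u / 2) := by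
  have hk : (0 : ℝ) < k + 1 := by positivity
  refine ⟨(1 + 2 * (k + 1) * c) ^ k, by positivity, fun u hu => ?_⟩
  have h1 : 1 + c * u ≤ (1 + 2 * (k + 1) * c) * Real.exp (u / (2 * (k + 1))) := by
    have h2 := Real.add_one_le_exp (u / (2 * (k + 1)))
    calc 1 + c * u ≤ (1 + 2 * (k + 1) * c) * (u / (2 * (k + 1)) + 1) := by
          have h3 : (1 + 2 * (k + 1) * c) * (u / (2 * (k + 1)) + 1) =
            1 + c * u + (u / (2 * (k + 1)) + 2 * (k + 1) * c) := by
            field_simp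
            ring
          rw [h3]
          have : 0 ≤ u / (2 * (k + 1)) + 2 * (k + 1) * c := by positivity
          linarith
      _ ≤ _ := by gcongr
  calc (1 + c * u) ^ k ≤ ((1 + 2 * (k + 1) * c) * Real.exp (u / (2 * (k + 1)))) ^ k := by gcongr
    _ = (1 + 2 * (k + 1) * c) ^ k * Real.exp (k * (u / (2 * (k + 1)))) := by
      rw [mul_pow, ← Real.exp_nat_mul]
    _ ≤ _ := by
      gcongr
      rw [mul_div_assoc', div_le_div_iff₀ (by positivity) two_pos]
      nlinarith

/-- Uniform large deviation bound with linear dependence on the number of summands, for summands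
whose tail is dominated by a dominantly varying one. -/
theorem exists_measureReal_lt_sum_le (hmeas : ∀ i, Measurable (Y i)) (hind : iIndepFun Y P)
    (hid : ∀ i, IdentDistrib (Y i) (Y 0) P P) (hnn : ∀ i ω, 0 ≤ Y i ω)
    (hint : Integrable (Y 0) P) {G : Measure ℝ} [IsProbabilityMeasure G]
    (hpos : ∀ x, 0 < tail G x) (hD : IsDominantlyVarying G) {C₀ : ℝ} (hC₀ : 0 ≤ C₀)
    (hdom : ∀ x, 0 ≤ x → P.real {ω | x < Y 0 ω} ≤ C₀ * tail G x)
    {d θ : ℝ} (hd : 0 < d) (hθ : 0 < θ) (hdθ : d * ∫ ω, Y 0 ω ∂P ≤ 1 - 3 * θ) :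
    ∃ C, 0 ≤ C ∧ ∀ (x : ℝ) (n : ℕ), 0 < x → (n : ℝ) ≤ d * x →
      P.real {ω | (1 - θ) * x < ∑ i ∈ Finset.range n, Y i ω} ≤ C * (n * tail G x) := by
  obtain ⟨C₁, k, hC₁, hpoly⟩ := hD.exists_tail_mul_le hpos
  have hδ : 0 < Real.log (1 + θ) := Real.log_pos (by linarith)
  obtain ⟨C₂, hC₂, hexp⟩ := exists_one_add_mul_pow_le (1 / (θ * Real.log (1 + θ)))
    (by positivity) k
  set b := ∫ ω, Y 0 ω ∂P
  have hb : 0 ≤ b := integral_nonneg (hnn 0)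
  refine ⟨C₀ * (C₁ * (1 + 1 / (θ / 2)) ^ k) + (1 + Real.exp (C₀ * C₁ * C₂)), by positivity,
    fun x n hx hn => ?_⟩
  have hG := hpos x
  set h := n * tail G x
  rcases Nat.eq_zero_or_pos n with rfl | hn0
  · have h1 : θ ≤ 1 := by nlinarith [mul_nonneg hd.le hb]
    have h2 : {ω : Ω | (1 - θ) * x < ∑ i ∈ Finset.range 0, Y i ω} = ∅ := by
      ext ω
      simpa using mul_nonneg (sub_nonneg.2 h1) hx.le
    rw [h2]
    simp [h]
  have hn0' : (0 : ℝ) < n := by exact_mod_cast hn0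
  have hh : 0 < h := mul_pos hn0' hG
  have hconst : 0 ≤ C₀ * (C₁ * (1 + 1 / (θ / 2)) ^ k) := by positivity
  have hE := Real.exp_pos (C₀ * C₁ * C₂)
  -- If `n * tail G x ≥ 1`, the claim is trivial because a probability is at most `1`.
  rcases le_or_gt 1 h with h1 | h1
  · have h2 : P.real {ω | (1 - θ) * x < ∑ i ∈ Finset.range n, Y i ω} ≤ 1 := measureReal_le_one
    nlinarith [mul_nonneg hconst hh.le, mul_pos hE hh]
  obtain ⟨u, hu⟩ : ∃ u, u = -Real.log h := ⟨_, rfl⟩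
  have hu0 : 0 < u := by
    rw [hu]
    exact neg_pos.2 (Real.log_neg hh h1)
  have hexpu : Real.exp (-u) = h := by rw [hu, neg_neg, Real.exp_log hh]
  -- With `exp (-u) = h = n * tail G x`, the parameters give `exp (s R) = 1 + θ`, `s T = u / 2` and
  -- `s y = u (1 - θ) / θ`. The drift is then at most `u (1 - 2 θ) / θ`, so the exponent is `-u` up
  -- to the jump term. That term is bounded because `h * exp (u / 2)` times a polynomial in `u` is
  -- bounded.
  have hmain := measureReal_lt_sum_le hmeas hind hid hnn hint (s := u / θ / x) (T := θ / 2 * x)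
    (by positivity) (by positivity) (Real.log (1 + θ) * θ / u * x) ((1 - θ) * x) n
  have hsR : u / θ / x * (Real.log (1 + θ) * θ / u * x) = Real.log (1 + θ) := by field_simp
  have hsT : u / θ / x * (θ / 2 * x) = u / 2 := by field_simp
  have hsy : u / θ / x * ((1 - θ) * x) = u / θ * (1 - θ) := by field_simp
  rw [hsR, hsT, hsy, Real.exp_log (by linarith)] at hmain
  have hfirst : n * P.real {ω | θ / 2 * x < Y 0 ω} ≤ C₀ * (C₁ * (1 + 1 / (θ / 2)) ^ k) * h := by
    calc _ ≤ n * (C₀ * (C₁ * (1 + 1 / (θ / 2)) ^ k * tail G x)) := by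
          gcongr
          exact (hdom _ (by positivity)).trans
            (mul_le_mul_of_nonneg_left (hpoly x _ hx.le (by positivity)) hC₀)
      _ = _ := by ring
  have hlin : n * (u / θ / x * b * (1 + θ)) ≤ u / θ * (1 - 2 * θ) := by
    calc n * (u / θ / x * b * (1 + θ)) ≤ d * x * (u / θ / x * b * (1 + θ)) := by gcongr
      _ = u / θ * (d * b * (1 + θ)) := by field_simp
      _ ≤ u / θ * (1 - 2 * θ) := by
        gcongr
        nlinarith
  have hjump : n * (Real.exp (u / 2) * P.real {ω | Real.log (1 + θ) * θ / u * x < Y 0 ω}) ≤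
      C₀ * C₁ * C₂ := by
    calc _ ≤ n * (Real.exp (u / 2) * (C₀ * (C₁ *
            (1 + 1 / (Real.log (1 + θ) * θ / u)) ^ k * tail G x))) := by
          gcongr
          exact (hdom _ (by positivity)).trans
            (mul_le_mul_of_nonneg_left (hpoly x _ hx.le (by positivity)) hC₀)
      _ = C₀ * C₁ * h * Real.exp (u / 2) * (1 + 1 / (θ * Real.log (1 + θ)) * u) ^ k := by
          have : 1 / (Real.log (1 + θ) * θ / u) = 1 / (θ * Real.log (1 + θ)) * u := by field_simp
          rw [this]
          ring
      _ ≤ C₀ * C₁ * h * Real.exp (u / 2) * (C₂ * Real.exp (u / 2)) := by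
          gcongr
          exact hexp u hu0.le
      _ = C₀ * C₁ * C₂ * (Real.exp (-u) * (Real.exp (u / 2) * Real.exp (u / 2))) := by
          rw [hexpu]
          ring
      _ = _ := by
          rw [← Real.exp_add, ← Real.exp_add]
          simp
  have hsecond : Real.exp (n * (u / θ / x * b * (1 + θ) +
      Real.exp (u / 2) * P.real {ω | Real.log (1 + θ) * θ / u * x < Y 0 ω}) - u / θ * (1 - θ)) ≤
      Real.exp (C₀ * C₁ * C₂) * h := by
    rw [← hexpu, ← Real.exp_add, Real.exp_le_exp]
    have h2 : u / θ * (1 - 2 * θ) - u / θ * (1 - θ) = -u := by field_simp; ring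
    nlinarith
  nlinarith

end LargeDeviations

/-! ### The fixed point equation -/

section FixedPoint

variable {Ω : Type*} [MeasurableSpace Ω] {P : Measure Ω} {A : Ω → ℕ} {B : ℕ → Ω → ℕ} {X : Ω → ℕ}

/-- `A + B_0 + ... + B_{n-1}`. -/
def stepSum (A : Ω → ℕ) (B : ℕ → Ω → ℕ) (n : ℕ) (ω : Ω) : ℕ :=
  A ω + ∑ i ∈ Finset.range n, B i ω

namespace IsFixedPoint

variable (h : IsFixedPoint P A B X)
include h

theorem measurable_stepSum (n : ℕ) : Measurable (stepSum A B n) :=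
  h.measurable_A.add (Finset.measurable_sum _ fun i _ => h.measurable_B i)

theorem measurable_stepSum_self : Measurable fun ω => stepSum A B (X ω) ω :=
  (measurable_from_prod_countable_right h.measurable_stepSum :
    Measurable fun z : ℕ × Ω => stepSum A B z.1 z.2).comp (h.measurable_X.prodMk measurable_id)

theorem measurable_real_A : Measurable fun ω => (A ω : ℝ) :=
  measurable_from_top.comp h.measurable_A

theorem measurable_real_B (i : ℕ) : Measurable fun ω => (B i ω : ℝ) :=
  measurable_from_top.comp (h.measurable_B i)

theorem measurable_real_X : Measurable fun ω => (X ω : ℝ) :=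
  measurable_from_top.comp h.measurable_X

theorem iIndepFun_real_B : iIndepFun (fun i ω => (B i ω : ℝ)) P :=
  h.indep_B.comp (fun _ n => (n : ℝ)) fun _ => measurable_from_top

theorem identDistrib_real_B (i : ℕ) :
    IdentDistrib (fun ω => (B i ω : ℝ)) (fun ω => (B 0 ω : ℝ)) P P :=
  (h.identDistrib_B i).comp (u := fun n : ℕ => (n : ℝ)) measurable_from_top

theorem indepFun_real_A_sum (n : ℕ) :
    IndepFun (fun ω => (A ω : ℝ)) (fun ω => ∑ i ∈ Finset.range n, (B i ω : ℝ)) P :=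
  h.indep_A_B.comp (φ := fun n : ℕ => (n : ℝ))
    (ψ := fun β : ℕ → ℕ => ∑ i ∈ Finset.range n, (β i : ℝ)) measurable_from_top
    (Finset.measurable_sum _ fun i _ => measurable_from_top.comp (measurable_pi_apply i))

theorem indepFun_real_sum_B (n : ℕ) :
    IndepFun (fun ω => ∑ i ∈ Finset.range n, (B i ω : ℝ)) (fun ω => (B n ω : ℝ)) P := by
  have h1 := h.iIndepFun_real_B.indepFun_finsetSum_of_notMem h.measurable_real_B
    (Finset.notMem_range_self (n := n))
  convert h1 using 1
  ext ω
  simp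

theorem integral_eq_integral_stepSum (φ : ℕ → ℝ) :
    ∫ ω, φ (X ω) ∂P = ∫ ω, φ (stepSum A B (X ω) ω) ∂P :=
  (h.fixedPoint.comp (u := φ) measurable_from_top).integral_eq

section Mean

variable (hA : Integrable (fun ω => (A ω : ℝ)) P) (hB : Integrable (fun ω => (B 0 ω : ℝ)) P)
include hA hB

theorem integrable_stepSum (n : ℕ) : Integrable (fun ω => (stepSum A B n ω : ℝ)) P := by
  simp only [stepSum, Nat.cast_add, Nat.cast_sum]
  exact hA.add (integrable_finsetSum _ fun i _ => (h.identDistrib_real_B i).integrable_iff.2 hB)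

theorem integral_stepSum (n : ℕ) : ∫ ω, (stepSum A B n ω : ℝ) ∂P =
    (∫ ω, (A ω : ℝ) ∂P) + n * ∫ ω, (B 0 ω : ℝ) ∂P := by
  have hi : ∀ i, Integrable (fun ω => (B i ω : ℝ)) P := fun i =>
    (h.identDistrib_real_B i).integrable_iff.2 hB
  simp only [stepSum, Nat.cast_add, Nat.cast_sum]
  rw [integral_add hA (integrable_finsetSum _ fun i _ => hi i),
    integral_finsetSum _ fun i _ => hi i,
    Finset.sum_congr rfl fun i _ => (h.identDistrib_real_B i).integral_eq]
  simp

end Mean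

variable [IsProbabilityMeasure P]

/-- Conditioning on `X` in the right-hand side of the fixed point equation. -/
theorem integral_comp_eq (φ : ℕ → ℕ → ℝ)
    (hφ : Integrable (fun ω => φ (X ω) (stepSum A B (X ω) ω)) P) :
    ∫ ω, φ (X ω) (stepSum A B (X ω) ω) ∂P =
      ∫ ω, ∫ ω', φ (X ω) (stepSum A B (X ω) ω') ∂P ∂P := by
  have hY : Measurable fun ω => (A ω, fun i => B i ω) :=
    h.measurable_A.prodMk (measurable_pi_lambda _ h.measurable_B)
  have hprod := (indepFun_iff_map_prod_eq_prod_map_map h.measurable_X.aemeasurable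
    hY.aemeasurable).1 h.indep_X
  let Ψ : ℕ × (ℕ × (ℕ → ℕ)) → ℝ := fun z => φ z.1 (z.2.1 + ∑ i ∈ Finset.range z.1, z.2.2 i)
  have hΨ : Measurable Ψ := by
    refine measurable_from_prod_countable_right fun n => ?_
    have : Measurable fun y : ℕ × (ℕ → ℕ) => y.1 + ∑ i ∈ Finset.range n, y.2 i :=
      measurable_fst.add (Finset.measurable_sum _ fun i _ =>
        (measurable_pi_apply i).comp measurable_snd)
    exact (measurable_from_top : Measurable (φ n)).comp this
  have hZ : Measurable fun ω => (X ω, (A ω, fun i => B i ω)) := h.measurable_X.prodMk hY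
  have := Measure.isProbabilityMeasure_map (μ := P) hY.aemeasurable
  have := Measure.isProbabilityMeasure_map (μ := P) h.measurable_X.aemeasurable
  have hint : Integrable Ψ ((P.map X).prod (P.map fun ω => (A ω, fun i => B i ω))) := by
    rw [← hprod]
    exact (integrable_map_measure hΨ.aestronglyMeasurable hZ.aemeasurable).2 hφ
  calc ∫ ω, φ (X ω) (stepSum A B (X ω) ω) ∂P
      = ∫ z, Ψ z ∂(P.map fun ω => (X ω, (A ω, fun i => B i ω))) :=
        (integral_map hZ.aemeasurable hΨ.aestronglyMeasurable).symm
    _ = ∫ n, ∫ y, Ψ (n, y) ∂(P.map fun ω => (A ω, fun i => B i ω)) ∂(P.map X) := by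
        rw [hprod, integral_prod _ hint]
    _ = ∫ ω, ∫ y, Ψ (X ω, y) ∂(P.map fun ω => (A ω, fun i => B i ω)) ∂P :=
        integral_map h.measurable_X.aemeasurable measurable_from_top.aestronglyMeasurable
    _ = _ := by
        refine integral_congr_ae (ae_of_all _ fun ω => ?_)
        exact integral_map hY.aemeasurable
          (hΨ.comp measurable_prodMk_left).aestronglyMeasurable

/-- `P(X > x)` as a mixture of the tails of `A + B_0 + ... + B_{n-1}`. -/
theorem measureReal_lt_eq_integral (x : ℝ) :
    P.real {ω | x < (X ω : ℝ)} = ∫ ω, P.real {ω' | x < (stepSum A B (X ω) ω' : ℝ)} ∂P := by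
  classical
  let φ : ℕ → ℝ := fun m => if x < (m : ℝ) then 1 else 0
  have hφ : ∀ Z : Ω → ℕ, Measurable Z → ∫ ω, φ (Z ω) ∂P = P.real {ω | x < (Z ω : ℝ)} := by
    intro Z hZ
    have hset : MeasurableSet {ω | x < (Z ω : ℝ)} :=
      (measurable_from_top.comp hZ : Measurable fun ω => (Z ω : ℝ)) measurableSet_Ioi
    have : (fun ω => φ (Z ω)) = {ω | x < (Z ω : ℝ)}.indicator 1 := by
      ext ω
      simp [φ, Set.indicator_apply]
    rw [this, integral_indicator_one hset]
  rw [← hφ X h.measurable_X, h.integral_eq_integral_stepSum φ,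
    h.integral_comp_eq (fun _ m => φ m)]
  · exact integral_congr_ae (ae_of_all _ fun ω => hφ _ (h.measurable_stepSum _))
  · refine integrable_of_abs_le
      ((measurable_from_top : Measurable φ).comp h.measurable_stepSum_self) 1
      fun ω => ?_
    simp only [φ]
    split_ifs <;> simp

section Mean

variable (hA : Integrable (fun ω => (A ω : ℝ)) P) (hB : Integrable (fun ω => (B 0 ω : ℝ)) P)
include hA hB

/-- Truncation at `K` keeps every integral finite before `X` is known to be integrable. Since `min ·
K` is concave, one use of the equation replaces the coefficient `c` by `c b` at the cost of `c a`.
-/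
theorem integral_min_le {c K : ℝ} (hc : 0 ≤ c) (hK : 0 ≤ K) :
    ∫ ω, min (c * X ω) K ∂P ≤ c * (∫ ω, (A ω : ℝ) ∂P) +
      ∫ ω, min (c * (∫ ω, (B 0 ω : ℝ) ∂P) * X ω) K ∂P := by
  have hb : 0 ≤ ∫ ω, (B 0 ω : ℝ) ∂P := integral_nonneg fun _ => Nat.cast_nonneg _
  have habs : ∀ t : ℝ, 0 ≤ t → |min t K| ≤ K := fun t ht => by
    rw [abs_of_nonneg (le_min ht hK)]
    exact min_le_right _ _
  have hintmin : ∀ (t : ℝ), 0 ≤ t → ∀ Z : Ω → ℕ, Measurable Z →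
      Integrable (fun ω => min (t * Z ω) K) P := fun t ht Z hZ =>
    integrable_of_abs_le
      (measurable_from_top.comp hZ : Measurable ((fun m : ℕ => min (t * (m : ℝ)) K) ∘ Z)) K
      fun ω => habs _ (by positivity)
  have hinner : ∀ n : ℕ, ∫ ω, min (c * stepSum A B n ω) K ∂P ≤
      c * (∫ ω, (A ω : ℝ) ∂P) + min (c * (∫ ω, (B 0 ω : ℝ) ∂P) * n) K := by
    intro n
    have ha : 0 ≤ ∫ ω, (A ω : ℝ) ∂P := integral_nonneg fun _ => Nat.cast_nonneg _
    rw [← min_add_add_left]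
    refine le_min ?_ ?_
    · calc _ ≤ ∫ ω, c * (stepSum A B n ω : ℝ) ∂P :=
            integral_mono (hintmin c hc _ (h.measurable_stepSum n))
              ((h.integrable_stepSum hA hB n).const_mul c) fun ω => min_le_left _ _
        _ = _ := by
          rw [integral_const_mul, h.integral_stepSum hA hB]
          ring
    · calc _ ≤ ∫ _, K ∂P := integral_mono (hintmin c hc _ (h.measurable_stepSum n))
              (integrable_const _) fun ω => min_le_right _ _
        _ ≤ _ := by
          simp only [integral_const, probReal_univ, one_smul]
          exact le_add_of_nonneg_left (by positivity)
  calc ∫ ω, min (c * X ω) K ∂P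
      = ∫ ω, ∫ ω', min (c * stepSum A B (X ω) ω') K ∂P ∂P := by
        rw [h.integral_eq_integral_stepSum fun m => min (c * (m : ℝ)) K]
        exact h.integral_comp_eq (fun _ m => min (c * (m : ℝ)) K)
          (hintmin c hc _ h.measurable_stepSum_self)
    _ ≤ ∫ ω, (c * (∫ ω, (A ω : ℝ) ∂P) + min (c * (∫ ω, (B 0 ω : ℝ) ∂P) * X ω) K) ∂P := by
        refine integral_mono_of_nonneg (ae_of_all _ fun ω => ?_)
          ((integrable_const _).add (hintmin _ (by positivity) _ h.measurable_X))
          (ae_of_all _ fun ω => hinner (X ω))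
        exact integral_nonneg fun ω' => le_min (by positivity) hK
    _ = _ := by
        rw [integral_add (integrable_const _) (hintmin _ (by positivity) _ h.measurable_X)]
        simp

/-- Iterating `integral_min_le` from `c = 1` accumulates `a (1 + b + b² + ...)`, and the remainder
`E min(b ^ N X, K)` vanishes by dominated convergence. The bound does not depend on `K`. -/
theorem integral_min_le_div (hb : ∫ ω, (B 0 ω : ℝ) ∂P < 1) {K : ℝ} (hK : 0 ≤ K) :
    ∫ ω, min (X ω : ℝ) K ∂P ≤ (∫ ω, (A ω : ℝ) ∂P) / (1 - ∫ ω, (B 0 ω : ℝ) ∂P) := by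
  set a := ∫ ω, (A ω : ℝ) ∂P
  set b := ∫ ω, (B 0 ω : ℝ) ∂P with hbdef
  have hb0 : 0 ≤ b := integral_nonneg fun _ => Nat.cast_nonneg _
  have ha0 : 0 ≤ a := integral_nonneg fun _ => Nat.cast_nonneg _
  have hiter : ∀ N : ℕ, ∫ ω, min (X ω : ℝ) K ∂P ≤
      a / (1 - b) + ∫ ω, min (b ^ N * X ω) K ∂P := by
    have h1 : ∀ N : ℕ, ∫ ω, min (X ω : ℝ) K ∂P ≤
        a * ∑ j ∈ Finset.range N, b ^ j + ∫ ω, min (b ^ N * X ω) K ∂P := by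
      intro N
      induction N with
      | zero => simp
      | succ N ih =>
        have h2 := h.integral_min_le hA hB (c := b ^ N) (by positivity) hK
        rw [← hbdef, ← pow_succ] at h2
        rw [Finset.sum_range_succ, mul_add]
        change _ ≤ b ^ N * a + _ at h2
        linarith
    intro N
    refine (h1 N).trans ?_
    rw [div_eq_mul_inv]
    gcongr
    rw [← tsum_geometric_of_lt_one hb0 hb]
    exact (summable_geometric_of_lt_one hb0 hb).sum_le_tsum _ fun _ _ => by positivity
  have hlim : Tendsto (fun N : ℕ => ∫ ω, min (b ^ N * X ω) K ∂P) atTop (𝓝 (∫ _, (0 : ℝ) ∂P)) := by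
    refine tendsto_integral_of_dominated_convergence (fun _ => K) (fun N => ?_)
      (integrable_const _) (fun N => ae_of_all _ fun ω => ?_) (ae_of_all _ fun ω => ?_)
    · exact ((h.measurable_real_X.const_mul _).min measurable_const).aestronglyMeasurable
    · rw [Real.norm_of_nonneg (le_min (by positivity) hK)]
      exact min_le_right _ _
    · have h1 : Tendsto (fun N : ℕ => b ^ N * (X ω : ℝ)) atTop (𝓝 0) := by
        simpa using (tendsto_pow_atTop_nhds_zero_of_lt_one hb0 hb).mul_const (X ω : ℝ)
      simpa [min_eq_left hK] using h1.min (tendsto_const_nhds (x := K))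
  have := ge_of_tendsto' (hlim.const_add (a / (1 - b))) hiter
  simpa using this

/-- A solution of the fixed point equation has finite mean. -/
theorem integrable_X (hb : ∫ ω, (B 0 ω : ℝ) ∂P < 1) : Integrable (fun ω => (X ω : ℝ)) P := by
  have hset : ∀ N : ℕ, MeasurableSet {ω | X ω ≤ N} := fun N =>
    h.measurable_X measurableSet_Iic
  have hcover : AECover P atTop fun N : ℕ => {ω | X ω ≤ N} :=
    ⟨ae_of_all _ fun ω => eventually_ge_atTop (X ω), hset⟩
  have hmin : ∀ N : ℕ, Integrable (fun ω => min (X ω : ℝ) N) P := fun N =>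
    integrable_of_abs_le (h.measurable_real_X.min measurable_const) N fun ω => by
      rw [abs_of_nonneg (by positivity)]
      exact min_le_right _ _
  have heq : ∀ N : ℕ, Set.EqOn (fun ω => min (X ω : ℝ) N) (fun ω => (X ω : ℝ)) {ω | X ω ≤ N} :=
    fun N ω hω => min_eq_left (by exact_mod_cast hω)
  refine hcover.integrable_of_integral_norm_bounded
    ((∫ ω, (A ω : ℝ) ∂P) / (1 - ∫ ω, (B 0 ω : ℝ) ∂P))
    (fun N => (hmin N).integrableOn.congr_fun (heq N) (hset N))
    (Eventually.of_forall fun N => ?_)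
  calc ∫ ω in {ω | X ω ≤ N}, ‖(X ω : ℝ)‖ ∂P = ∫ ω in {ω | X ω ≤ N}, min (X ω : ℝ) N ∂P := by
        simp only [RCLike.norm_natCast]
        exact (setIntegral_congr_fun (hset N) (heq N)).symm
    _ ≤ ∫ ω, min (X ω : ℝ) N ∂P :=
        setIntegral_le_integral (hmin N) (ae_of_all _ fun ω => by positivity)
    _ ≤ _ := h.integral_min_le_div hA hB hb N.cast_nonneg

theorem integral_X (hb : ∫ ω, (B 0 ω : ℝ) ∂P < 1) :
    ∫ ω, (X ω : ℝ) ∂P = (∫ ω, (A ω : ℝ) ∂P) / (1 - ∫ ω, (B 0 ω : ℝ) ∂P) := by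
  have hX := h.integrable_X hA hB hb
  have hS : Integrable (fun ω => (stepSum A B (X ω) ω : ℝ)) P :=
    ((h.fixedPoint.comp (u := fun n : ℕ => (n : ℝ)) measurable_from_top).integrable_iff).1 hX
  have h1 : ∫ ω, (X ω : ℝ) ∂P =
      (∫ ω, (A ω : ℝ) ∂P) + (∫ ω, (X ω : ℝ) ∂P) * ∫ ω, (B 0 ω : ℝ) ∂P := by
    conv_lhs =>
      rw [h.integral_eq_integral_stepSum fun n : ℕ => (n : ℝ),
        h.integral_comp_eq (fun _ m => (m : ℝ)) hS]
    simp only [h.integral_stepSum hA hB]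
    rw [integral_add (integrable_const _) (hX.mul_const _), integral_mul_const]
    simp
  rw [eq_div_iff (by linarith)]
  linarith

end Mean

end IsFixedPoint

end FixedPoint

/-! ### Iterating the one-step inequalities -/

section Iteration

theorem le_mul_tsum_of_le_add {F g : ℝ → ℝ} {c d x₀ : ℝ} (hd : 1 < d) (hc : 0 ≤ c)
    (hg : ∀ x, 0 ≤ g x) (hx₀ : 0 < x₀) (hF : Tendsto F atTop (𝓝 0))
    (hsum : ∀ x, 0 < x → Summable fun n : ℕ => g (d ^ n * x))
    (hstep : ∀ x, x₀ ≤ x → F x ≤ c * g x + F (d * x)) {x : ℝ} (hx : x₀ ≤ x) :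
    F x ≤ c * ∑' n : ℕ, g (d ^ n * x) := by
  have hx0 : 0 < x := hx₀.trans_le hx
  have hiter : ∀ N : ℕ, F x ≤ c * (∑ n ∈ Finset.range N, g (d ^ n * x)) + F (d ^ N * x) := by
    intro N
    induction N with
    | zero => simp
    | succ N ih =>
      have h1 := hstep (d ^ N * x) (hx.trans (le_mul_of_one_le_left hx0.le (one_le_pow₀ hd.le)))
      rw [← mul_assoc d, ← pow_succ'] at h1
      rw [Finset.sum_range_succ, mul_add]
      linarith
  have hlim : Tendsto (fun N : ℕ => F (d ^ N * x)) atTop (𝓝 0) :=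
    hF.comp ((tendsto_pow_atTop_atTop_of_one_lt hd).atTop_mul_const hx0)
  have := ge_of_tendsto' (hlim.const_add (c * ∑' n : ℕ, g (d ^ n * x))) fun N =>
    (hiter N).trans (add_le_add_left (mul_le_mul_of_nonneg_left
      ((hsum x hx0).sum_le_tsum _ fun n _ => hg _) hc) _)
  simpa using this

/-- The product of the factors `1 - C / (d ^ n x)` is at least `1` minus the sum of the losses, a
geometric series with value `C d / ((d - 1) x)`. The induction varies `x`, moving the starting point
to `d * x`. -/
theorem mul_tsum_le_of_add_le {F g : ℝ → ℝ} {c d C x₀ : ℝ} (hd : 1 < d) (hc : 0 ≤ c)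
    (hC : 0 ≤ C) (hg : ∀ x, 0 ≤ g x) (hx₀ : 0 < x₀) (hF : ∀ x, 0 ≤ F x)
    (hsum : ∀ x, 0 < x → Summable fun n : ℕ => g (d ^ n * x))
    (hstep : ∀ x, x₀ ≤ x → c * g x + (1 - C / x) * F (d * x) ≤ F x) {x : ℝ} (hx : x₀ ≤ x)
    (hCx : C * d / (d - 1) ≤ x) :
    (1 - C * d / (d - 1) / x) * (c * ∑' n : ℕ, g (d ^ n * x)) ≤ F x := by
  have hd1 : 0 < d - 1 := by linarith
  have hd0 : 0 < d := by linarith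
  have hC' : 0 ≤ C * d / (d - 1) := by positivity
  have hiter : ∀ (N : ℕ) (x : ℝ), x₀ ≤ x → C * d / (d - 1) ≤ x →
      (1 - C * d / (d - 1) / x) * (c * ∑ n ∈ Finset.range N, g (d ^ n * x)) ≤ F x := by
    intro N
    induction N with
    | zero => intro x _ _; simpa using hF x
    | succ N ih =>
      intro x hx hCx
      have hx0 : 0 < x := hx₀.trans_le hx
      have hdx : x ≤ d * x := le_mul_of_one_le_left hx0.le hd.le
      have h1 := ih (d * x) (hx.trans hdx) (hCx.trans hdx)
      have hCle : C ≤ C * d / (d - 1) := by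
        rw [le_div_iff₀ hd1]
        nlinarith
      have h2 : 0 ≤ 1 - C / x := by
        rw [sub_nonneg, div_le_one hx0]
        exact hCle.trans hCx
      have hS : 0 ≤ c * ∑ n ∈ Finset.range N, g (d ^ n * (d * x)) :=
        mul_nonneg hc (Finset.sum_nonneg fun _ _ => hg _)
      have hcg : 0 ≤ c * g x := mul_nonneg hc (hg x)
      -- `K = C d / (d - 1)` solves `K / x = C / x + K / (d x)`, which closes the induction.
      have h3 : 1 - C * d / (d - 1) / x ≤ (1 - C / x) * (1 - C * d / (d - 1) / (d * x)) := by
        have h4 : C * d / (d - 1) / x = C / x + C * d / (d - 1) / (d * x) := by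
          field_simp
          ring
        have h5 : 0 ≤ C / x * (C * d / (d - 1) / (d * x)) := by positivity
        nlinarith
      have h6 : 1 - C * d / (d - 1) / x ≤ 1 := by
        have : 0 ≤ C * d / (d - 1) / x := by positivity
        linarith
      rw [Finset.sum_range_succ']
      have h7 : ∑ k ∈ Finset.range N, g (d ^ (k + 1) * x) =
          ∑ n ∈ Finset.range N, g (d ^ n * (d * x)) :=
        Finset.sum_congr rfl fun k _ => by rw [pow_succ, mul_assoc]
      rw [h7, pow_zero, one_mul, mul_add, mul_add]
      calc _ ≤ (1 - C / x) * (1 - C * d / (d - 1) / (d * x)) *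
              (c * ∑ n ∈ Finset.range N, g (d ^ n * (d * x))) + 1 * (c * g x) := by gcongr
        _ ≤ (1 - C / x) * F (d * x) + c * g x := by
            rw [mul_assoc, one_mul]
            gcongr
        _ ≤ _ := by linarith [hstep x hx]
  have hx0 : 0 < x := hx₀.trans_le hx
  exact le_of_tendsto' (((hsum x hx0).hasSum.tendsto_sum_nat.const_mul c).const_mul _)
    fun N => hiter N x hx hCx

end Iteration

/-! ### Tails of the step distribution -/

section StepTail

theorem stepSum_cast {Ω : Type*} (A : Ω → ℕ) (B : ℕ → Ω → ℕ) (n : ℕ) (ω : Ω) :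
    (stepSum A B n ω : ℝ) = A ω + ∑ i ∈ Finset.range n, (B i ω : ℝ) := by
  simp [stepSum]

variable {Ω : Type*} [MeasurableSpace Ω] {P : Measure Ω} {G : Measure ℝ} [IsProbabilityMeasure G]

theorem exists_measureReal_le_mul_tail [IsProbabilityMeasure P] (hpos : ∀ x, 0 < tail G x)
    {U : Ω → ℝ} {u : ℝ} (h : TailLimsupLE P G U u) :
    ∃ C, 0 ≤ C ∧ ∀ x, P.real {ω | x < U ω} ≤ C * tail G x := by
  obtain ⟨x₀, hx₀⟩ := eventually_atTop.1 (h 1 one_pos)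
  refine ⟨max (u + 1) (tail G x₀)⁻¹, (inv_nonneg.2 (tail_nonneg _ _)).trans (le_max_right _ _),
    fun x => ?_⟩
  rcases le_total x₀ x with hx | hx
  · exact (hx₀ x hx).trans (mul_le_mul_of_nonneg_right (le_max_left _ _) (tail_nonneg _ _))
  · calc P.real {ω | x < U ω} ≤ 1 := measureReal_le_one
      _ = (tail G x₀)⁻¹ * tail G x₀ := (inv_mul_cancel₀ (hpos _).ne').symm
      _ ≤ _ := by
        have h1 : 0 ≤ (tail G x₀)⁻¹ := inv_nonneg.2 (tail_nonneg _ _)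
        exact mul_le_mul (le_max_right _ _) (tail_antitone hx) (tail_nonneg _ _)
          (h1.trans (le_max_right _ _))

variable {A : Ω → ℕ} {B : ℕ → Ω → ℕ} {X : Ω → ℕ} {c₁ c₂ : ℝ}

namespace IsFixedPoint

variable (h : IsFixedPoint P A B X)
include h

theorem measureReal_lt_B_eq (i : ℕ) (x : ℝ) :
    P.real {ω | x < (B i ω : ℝ)} = P.real {ω | x < (B 0 ω : ℝ)} :=
  congrArg ENNReal.toReal ((h.identDistrib_real_B i).measure_mem_eq measurableSet_Ioi)

theorem measurable_sum_B (n : ℕ) : Measurable fun ω => ∑ i ∈ Finset.range n, (B i ω : ℝ) :=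
  Finset.measurable_sum _ fun i _ => h.measurable_real_B i

variable [IsProbabilityMeasure P]

omit [IsProbabilityMeasure G] in
theorem tailLiminfGE_stepSum (hc₂ : 0 ≤ c₂)
    (hA : TailLiminfGE P G (fun ω => (A ω : ℝ)) c₁)
    (hB : TailLiminfGE P G (fun ω => (B 0 ω : ℝ)) c₂) (n : ℕ) :
    TailLiminfGE P G (fun ω => (stepSum A B n ω : ℝ)) (c₁ + n * c₂) := by
  have hS : ∀ n : ℕ, TailLiminfGE P G (fun ω => ∑ i ∈ Finset.range n, (B i ω : ℝ)) (n * c₂) := by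
    intro n
    induction n with
    | zero =>
      intro ε hε
      refine Eventually.of_forall fun x => le_trans ?_ measureReal_nonneg
      have := mul_nonneg hε.lt.le (tail_nonneg G x)
      rw [Nat.cast_zero, zero_mul]
      linarith
    | succ n ih =>
      have h1 := ih.add (h.measurable_sum_B n) (h.measurable_real_B n)
        (fun ω => Finset.sum_nonneg fun _ _ => Nat.cast_nonneg _) (fun ω => Nat.cast_nonneg _)
        (h.indepFun_real_sum_B n) hc₂ (fun ε hε => by
          simpa only [h.measureReal_lt_B_eq n] using hB ε hε)
      simp only [Finset.sum_range_succ]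
      rwa [Nat.cast_succ, add_one_mul]
  simp only [stepSum_cast]
  exact hA.add h.measurable_real_A (h.measurable_sum_B n) (fun ω => Nat.cast_nonneg _)
    (fun ω => Finset.sum_nonneg fun _ _ => Nat.cast_nonneg _) (h.indepFun_real_A_sum n)
    (by positivity) (hS n)

theorem tailLimsupLE_stepSum (hpos : ∀ x, 0 < tail G x) (hD : IsDominantlyVarying G)
    (hL : IsLongTailed G) (hc₁ : 0 ≤ c₁) (hc₂ : 0 ≤ c₂)
    (hA : TailLimsupLE P G (fun ω => (A ω : ℝ)) c₁)
    (hB : TailLimsupLE P G (fun ω => (B 0 ω : ℝ)) c₂) (n : ℕ) :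
    TailLimsupLE P G (fun ω => (stepSum A B n ω : ℝ)) (c₁ + n * c₂) := by
  obtain ⟨C, hC, hhalf⟩ : ∃ C : ℝ, 1 ≤ C ∧ ∀ x, 0 ≤ x → tail G (x / 2) ≤ C * tail G x := by
    obtain ⟨C, k, hC, hpoly⟩ := hD.exists_tail_mul_le hpos
    refine ⟨C * (1 + 1 / (1 / 2)) ^ k, ?_, fun x hx => ?_⟩
    · exact one_le_mul_of_one_le_of_one_le hC (one_le_pow₀ (by norm_num))
    · have := hpoly x (1 / 2) hx (by norm_num)
      rwa [one_div_mul_eq_div] at this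
  have hS : ∀ n : ℕ, TailLimsupLE P G (fun ω => ∑ i ∈ Finset.range n, (B i ω : ℝ)) (n * c₂) := by
    intro n
    induction n with
    | zero =>
      intro ε hε
      filter_upwards [eventually_ge_atTop 0] with x hx
      have h1 : {ω : Ω | x < ∑ i ∈ Finset.range 0, (B i ω : ℝ)} = ∅ := by
        ext ω
        simpa using hx
      rw [h1, measureReal_empty]
      have := tail_nonneg G x
      positivity
    | succ n ih =>
      have h1 := ih.add hL hpos hC hhalf (h.measurable_sum_B n) (h.measurable_real_B n)
        (h.indepFun_real_sum_B n) (by positivity) hc₂ (fun ε hε => by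
          simpa only [h.measureReal_lt_B_eq n] using hB ε hε)
      simp only [Finset.sum_range_succ]
      rwa [Nat.cast_succ, add_one_mul]
  simp only [stepSum_cast]
  exact hA.add hL hpos hC hhalf h.measurable_real_A (h.measurable_sum_B n)
    (h.indepFun_real_A_sum n) hc₁ (by positivity) (hS n)

/-- Uniform bound for the tail of `A + B_0 + ... + B_{n-1}` in the region `n ≤ d x`, `d E B < 1`. -/
theorem exists_measureReal_lt_stepSum_le (hpos : ∀ x, 0 < tail G x) (hD : IsDominantlyVarying G)
    (hint : Integrable (fun ω => (B 0 ω : ℝ)) P)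
    (hA : TailLimsupLE P G (fun ω => (A ω : ℝ)) c₁)
    (hB : TailLimsupLE P G (fun ω => (B 0 ω : ℝ)) c₂)
    {d : ℝ} (hd : 0 < d) (hdb : d * ∫ ω, (B 0 ω : ℝ) ∂P < 1) :
    ∃ C, 0 ≤ C ∧ ∀ (x : ℝ) (n : ℕ), 0 < x → (n : ℝ) ≤ d * x →
      P.real {ω | x < (stepSum A B n ω : ℝ)} ≤ C * (1 + n) * tail G x := by
  obtain ⟨θ, hθ⟩ : ∃ θ, θ = (1 - d * ∫ ω, (B 0 ω : ℝ) ∂P) / 3 := ⟨_, rfl⟩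
  have hθ0 : 0 < θ := by linarith
  obtain ⟨C₀, hC₀, hA'⟩ := exists_measureReal_le_mul_tail hpos hA
  obtain ⟨C₁, hC₁, hB'⟩ := exists_measureReal_le_mul_tail hpos hB
  obtain ⟨C₂, k, hC₂, hpoly⟩ := hD.exists_tail_mul_le hpos
  obtain ⟨C₃, hC₃, hsum⟩ := exists_measureReal_lt_sum_le h.measurable_real_B h.iIndepFun_real_B
    h.identDistrib_real_B (fun i ω => Nat.cast_nonneg _) hint hpos hD hC₁ (fun x _ => hB' x)
    hd hθ0 (by linarith)
  have hK : 0 ≤ C₀ * (C₂ * (1 + 1 / θ) ^ k) := by positivity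
  refine ⟨C₀ * (C₂ * (1 + 1 / θ) ^ k) + C₃, by positivity, fun x n hx hn => ?_⟩
  -- A fraction `θ` of the level goes to `A`; taking `θ` as a third of the slack `1 - d E B` leaves
  -- enough room for the sum of the `B i`.
  have hcover : {ω | x < (stepSum A B n ω : ℝ)} ⊆
      {ω | θ * x < (A ω : ℝ)} ∪ {ω | (1 - θ) * x < ∑ i ∈ Finset.range n, (B i ω : ℝ)} := by
    intro ω hω
    rw [Set.mem_ofPred_eq, stepSum_cast] at hω
    simp only [Set.mem_union, Set.mem_ofPred_eq]
    by_contra! hcon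
    linarith
  have hG := tail_nonneg G x
  have h1 : P.real {ω | θ * x < (A ω : ℝ)} ≤ C₀ * (C₂ * (1 + 1 / θ) ^ k) * tail G x := by
    refine (hA' _).trans ?_
    rw [mul_assoc]
    exact mul_le_mul_of_nonneg_left (hpoly x θ hx.le hθ0) hC₀
  have h2 := (measureReal_mono (μ := P) hcover).trans (measureReal_union_le _ _)
  have h3 := hsum x n hx hn
  have h4 : 0 ≤ C₀ * (C₂ * (1 + 1 / θ) ^ k) * (n * tail G x) := by positivity
  have h5 : 0 ≤ C₃ * tail G x := by positivity
  nlinarith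

/-! ### One step of the recursion for the tail of `X` -/

theorem integrable_ite_stepSum (p : ℕ → Prop) [DecidablePred p] (x : ℝ) :
    Integrable (fun ω => if p (X ω) then
      P.real {ω' | x < (stepSum A B (X ω) ω' : ℝ)} else 0) P := by
  refine integrable_of_abs_le ((measurable_from_top : Measurable fun n : ℕ => if p n then
      P.real {ω' | x < (stepSum A B n ω' : ℝ)} else 0).comp h.measurable_X) 1 fun ω => ?_
  split_ifs
  · rw [abs_of_nonneg measureReal_nonneg]
    exact measureReal_le_one
  · simp

omit h in
theorem eventually_natCast_le_mul {d : ℝ} (hd : 0 < d) (n : ℕ) :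
    ∀ᶠ x : ℝ in atTop, (n : ℝ) ≤ d * x :=
  (tendsto_id.const_mul_atTop hd).eventually_ge_atTop _

omit [IsProbabilityMeasure G] in
open Classical in
-- Fatou's lemma in the form of dominated convergence: the ratio is capped at its limiting lower
-- bound `c₁ + n c₂`, which is integrable at `n = X`.
theorem eventually_le_integral_ite (hpos : ∀ x, 0 < tail G x) (hc₁ : 0 ≤ c₁) (hc₂ : 0 ≤ c₂)
    (hA : TailLiminfGE P G (fun ω => (A ω : ℝ)) c₁)
    (hB : TailLiminfGE P G (fun ω => (B 0 ω : ℝ)) c₂)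
    (hX : Integrable (fun ω => (X ω : ℝ)) P) {d : ℝ} (hd : 0 < d) {ε : ℝ} (hε : 0 < ε) :
    ∀ᶠ x in atTop, (c₁ + (∫ ω, (X ω : ℝ) ∂P) * c₂ - ε) * tail G x ≤
      ∫ ω, (if (X ω : ℝ) ≤ d * x then
        P.real {ω' | x < (stepSum A B (X ω) ω' : ℝ)} else 0) ∂P := by
  let f : ℝ → ℕ → ℝ := fun x n => if (n : ℝ) ≤ d * x then
    min (P.real {ω' | x < (stepSum A B n ω' : ℝ)} / tail G x) (c₁ + n * c₂) else 0
  have hf0 : ∀ x n, 0 ≤ f x n := by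
    intro x n
    simp only [f]
    split_ifs
    · exact le_min (div_nonneg measureReal_nonneg (hpos x).le) (by positivity)
    · exact le_rfl
  have hf1 : ∀ x n, f x n ≤ c₁ + n * c₂ := by
    intro x n
    simp only [f]
    split_ifs
    · exact min_le_right _ _
    · positivity
  have hbound : Integrable (fun ω => c₁ + (X ω : ℝ) * c₂) P :=
    (integrable_const _).add (hX.mul_const _)
  have hmeas : ∀ x, AEStronglyMeasurable (fun ω => f x (X ω)) P := fun x =>
    ((measurable_from_top : Measurable (f x)).comp h.measurable_X).aestronglyMeasurable
  have hlim : Tendsto (fun x => ∫ ω, f x (X ω) ∂P) atTop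
      (𝓝 (∫ ω, (c₁ + (X ω : ℝ) * c₂) ∂P)) := by
    refine tendsto_integral_filter_of_dominated_convergence (fun ω => c₁ + (X ω : ℝ) * c₂)
      (Eventually.of_forall hmeas) (Eventually.of_forall fun x => ae_of_all _ fun ω => ?_) hbound
      (ae_of_all _ fun ω => ?_)
    · rw [Real.norm_of_nonneg (hf0 _ _)]
      exact hf1 _ _
    · refine tendsto_order.2 ⟨fun z hz => ?_, fun z hz =>
        Eventually.of_forall fun x => (hf1 x (X ω)).trans_lt hz⟩
      filter_upwards [eventually_natCast_le_mul hd (X ω), h.tailLiminfGE_stepSum hc₂ hA hB (X ω)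
        ((c₁ + X ω * c₂ - z) / 2) (by linarith)] with x h1 h2
      simp only [f, if_pos h1]
      rw [← le_div_iff₀ (hpos x)] at h2
      exact lt_min (lt_of_lt_of_le (by linarith) h2) hz
  have hval : ∫ ω, (c₁ + (X ω : ℝ) * c₂) ∂P = c₁ + (∫ ω, (X ω : ℝ) ∂P) * c₂ := by
    rw [integral_add (integrable_const _) (hX.mul_const _), integral_mul_const]
    simp
  rw [hval] at hlim
  filter_upwards [hlim.eventually (lt_mem_nhds (sub_lt_self _ hε))] with x hx
  calc _ ≤ (∫ ω, f x (X ω) ∂P) * tail G x := by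
        gcongr
        exact (hpos x).le
    _ = ∫ ω, f x (X ω) * tail G x ∂P := (integral_mul_const _ _).symm
    _ ≤ _ := by
        refine integral_mono_of_nonneg (ae_of_all _ fun ω => mul_nonneg (hf0 _ _) (hpos x).le)
          (h.integrable_ite_stepSum (fun n => (n : ℝ) ≤ d * x) x) (ae_of_all _ fun ω => ?_)
        simp only [f]
        split_ifs
        · rw [← le_div_iff₀ (hpos x)]
          exact min_le_left _ _
        · simp

open Classical in
-- The uniform bound `C (1 + n)` dominates the ratio on `n ≤ d x`. Raising the ratio to at least `c₁
-- + n c₂` leaves only the upper half of the pointwise limit to check.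
theorem eventually_integral_ite_le (hpos : ∀ x, 0 < tail G x) (hD : IsDominantlyVarying G)
    (hL : IsLongTailed G) (hc₁ : 0 ≤ c₁) (hc₂ : 0 ≤ c₂)
    (hint : Integrable (fun ω => (B 0 ω : ℝ)) P)
    (hA : TailLimsupLE P G (fun ω => (A ω : ℝ)) c₁)
    (hB : TailLimsupLE P G (fun ω => (B 0 ω : ℝ)) c₂)
    (hX : Integrable (fun ω => (X ω : ℝ)) P) {d : ℝ} (hd : 0 < d)
    (hdb : d * ∫ ω, (B 0 ω : ℝ) ∂P < 1) {ε : ℝ} (hε : 0 < ε) :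
    ∀ᶠ x in atTop, ∫ ω, (if (X ω : ℝ) ≤ d * x then
        P.real {ω' | x < (stepSum A B (X ω) ω' : ℝ)} else 0) ∂P ≤
      (c₁ + (∫ ω, (X ω : ℝ) ∂P) * c₂ + ε) * tail G x := by
  obtain ⟨C, hC, hunif⟩ := h.exists_measureReal_lt_stepSum_le hpos hD hint hA hB hd hdb
  let f : ℝ → ℕ → ℝ := fun x n => if (n : ℝ) ≤ d * x then
    max (P.real {ω' | x < (stepSum A B n ω' : ℝ)} / tail G x) (c₁ + n * c₂) else c₁ + n * c₂
  have hf0 : ∀ x n, c₁ + n * c₂ ≤ f x n := by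
    intro x n
    simp only [f]
    split_ifs
    · exact le_max_right _ _
    · exact le_rfl
  have hbound : Integrable (fun ω => C * (1 + (X ω : ℝ)) + (c₁ + (X ω : ℝ) * c₂)) P :=
    (((integrable_const _).add hX).const_mul C).add ((integrable_const _).add (hX.mul_const _))
  have hmeas : ∀ x, AEStronglyMeasurable (fun ω => f x (X ω)) P := fun x =>
    ((measurable_from_top : Measurable (f x)).comp h.measurable_X).aestronglyMeasurable
  have hfb : ∀ x n, 0 < x → ‖f x n‖ ≤ C * (1 + (n : ℝ)) + (c₁ + n * c₂) := by
    intro x n hx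
    have h1 : 0 ≤ c₁ + n * c₂ := by positivity
    rw [Real.norm_of_nonneg (h1.trans (hf0 x n))]
    simp only [f]
    split_ifs with hn
    · refine max_le ?_ (le_add_of_nonneg_left (by positivity))
      exact ((div_le_iff₀ (hpos x)).2 (hunif x n hx hn)).trans (le_add_of_nonneg_right h1)
    · exact le_add_of_nonneg_left (by positivity)
  have hlim : Tendsto (fun x => ∫ ω, f x (X ω) ∂P) atTop
      (𝓝 (∫ ω, (c₁ + (X ω : ℝ) * c₂) ∂P)) := by
    refine tendsto_integral_filter_of_dominated_convergence _
      (Eventually.of_forall hmeas) ?_ hbound (ae_of_all _ fun ω => ?_)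
    · filter_upwards [eventually_gt_atTop 0] with x hx
      exact ae_of_all _ fun ω => hfb x _ hx
    · refine tendsto_order.2 ⟨fun z hz =>
        Eventually.of_forall fun x => hz.trans_le (hf0 x (X ω)), fun z hz => ?_⟩
      filter_upwards [h.tailLimsupLE_stepSum hpos hD hL hc₁ hc₂ hA hB (X ω)
        ((z - (c₁ + X ω * c₂)) / 2) (by linarith)] with x h2
      simp only [f]
      split_ifs
      · rw [← div_le_iff₀ (hpos x)] at h2
        exact max_lt (lt_of_le_of_lt h2 (by linarith)) hz
      · exact hz
  have hval : ∫ ω, (c₁ + (X ω : ℝ) * c₂) ∂P = c₁ + (∫ ω, (X ω : ℝ) ∂P) * c₂ := by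
    rw [integral_add (integrable_const _) (hX.mul_const _), integral_mul_const]
    simp
  rw [hval] at hlim
  filter_upwards [hlim.eventually (gt_mem_nhds (lt_add_of_pos_right _ hε)),
    eventually_gt_atTop 0] with x hx hx0
  calc _ ≤ ∫ ω, f x (X ω) * tail G x ∂P := by
        refine integral_mono (h.integrable_ite_stepSum (fun n => (n : ℝ) ≤ d * x) x)
          (Integrable.mul_const (hbound.mono' (hmeas x) (ae_of_all _ fun ω => hfb x _ hx0)) _)
          fun ω => ?_
        simp only [f]
        split_ifs
        · rw [← div_le_iff₀ (hpos x)]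
          exact le_max_left _ _
        · exact mul_nonneg (by positivity) (hpos x).le
    _ = (∫ ω, f x (X ω) ∂P) * tail G x := integral_mul_const _ _
    _ ≤ _ := by
        gcongr
        exact (hpos x).le

open Classical in
theorem measureReal_lt_eq_integral_add (d x : ℝ) :
    P.real {ω | x < (X ω : ℝ)} =
      ∫ ω, (if (X ω : ℝ) ≤ d * x then
        P.real {ω' | x < (stepSum A B (X ω) ω' : ℝ)} else 0) ∂P +
      ∫ ω, (if d * x < (X ω : ℝ) then
        P.real {ω' | x < (stepSum A B (X ω) ω' : ℝ)} else 0) ∂P := by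
  rw [h.measureReal_lt_eq_integral x,
    ← integral_add (h.integrable_ite_stepSum (fun n => (n : ℝ) ≤ d * x) x)
      (h.integrable_ite_stepSum (fun n => d * x < (n : ℝ)) x)]
  refine integral_congr_ae (ae_of_all _ fun ω => ?_)
  by_cases hω : (X ω : ℝ) ≤ d * x
  · simp [hω, hω.not_gt]
  · simp [hω, not_le.1 hω]

omit [IsProbabilityMeasure P] in
open Classical in
theorem integral_ite_const (y t : ℝ) :
    ∫ ω, (if y < (X ω : ℝ) then t else 0) ∂P = t * P.real {ω | y < (X ω : ℝ)} := by
  have h1 : (fun ω => if y < (X ω : ℝ) then t else 0) =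
      {ω | y < (X ω : ℝ)}.indicator fun _ => t := by
    ext ω
    simp [Set.indicator_apply]
  have h2 : MeasurableSet {ω | y < (X ω : ℝ)} := h.measurable_real_X measurableSet_Ioi
  rw [h1, integral_indicator h2]
  simp [mul_comm]

/-- Upper step of the recursion: on `X > d x` the conditional probability is bounded by `1`. -/
theorem eventually_measureReal_lt_le (hpos : ∀ x, 0 < tail G x) (hD : IsDominantlyVarying G)
    (hL : IsLongTailed G) (hc₁ : 0 ≤ c₁) (hc₂ : 0 ≤ c₂)
    (hint : Integrable (fun ω => (B 0 ω : ℝ)) P)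
    (hA : TailLimsupLE P G (fun ω => (A ω : ℝ)) c₁)
    (hB : TailLimsupLE P G (fun ω => (B 0 ω : ℝ)) c₂)
    (hX : Integrable (fun ω => (X ω : ℝ)) P) {d : ℝ} (hd : 0 < d)
    (hdb : d * ∫ ω, (B 0 ω : ℝ) ∂P < 1) {ε : ℝ} (hε : 0 < ε) :
    ∀ᶠ x in atTop, P.real {ω | x < (X ω : ℝ)} ≤
      (c₁ + (∫ ω, (X ω : ℝ) ∂P) * c₂ + ε) * tail G x + P.real {ω | d * x < (X ω : ℝ)} := by
  classical
  filter_upwards [h.eventually_integral_ite_le hpos hD hL hc₁ hc₂ hint hA hB hX hd hdb hε]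
    with x hx
  rw [h.measureReal_lt_eq_integral_add d x]
  refine add_le_add hx ?_
  rw [← one_mul (P.real _), ← h.integral_ite_const]
  refine integral_mono (h.integrable_ite_stepSum (fun n => d * x < (n : ℝ)) x) ?_ fun ω => ?_
  · refine integrable_of_abs_le ((measurable_from_top : Measurable fun n : ℕ =>
      if d * x < (n : ℝ) then (1 : ℝ) else 0).comp h.measurable_X) 1 fun ω => ?_
    split_ifs <;> simp
  · dsimp only
    split_ifs
    · exact measureReal_le_one
    · exact le_rfl

omit [IsProbabilityMeasure G] in
-- Lower step of the recursion: for `n > d x` one has `n / d > x` with `1 / d < E B`, so the `B`-sum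
-- alone exceeds `x` with probability at least `1 - C / n`. The loss constant is chosen before `ε`.
theorem exists_eventually_le_measureReal_lt (hpos : ∀ x, 0 < tail G x)
    (hc₁ : 0 ≤ c₁) (hc₂ : 0 ≤ c₂)
    (hint : Integrable (fun ω => (B 0 ω : ℝ)) P)
    (hA : TailLiminfGE P G (fun ω => (A ω : ℝ)) c₁)
    (hB : TailLiminfGE P G (fun ω => (B 0 ω : ℝ)) c₂)
    (hX : Integrable (fun ω => (X ω : ℝ)) P) {d : ℝ} (hd : 0 < d)
    (hdb : 1 < d * ∫ ω, (B 0 ω : ℝ) ∂P) :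
    ∃ C > 0, ∀ ε > 0, ∀ᶠ x in atTop, (c₁ + (∫ ω, (X ω : ℝ) ∂P) * c₂ - ε) * tail G x +
      (1 - C / x) * P.real {ω | d * x < (X ω : ℝ)} ≤ P.real {ω | x < (X ω : ℝ)} := by
  classical
  obtain ⟨C, hC, hlow⟩ := exists_measureReal_sum_le_le h.measurable_real_B h.iIndepFun_real_B
    h.identDistrib_real_B (fun i ω => Nat.cast_nonneg _) hint (m := 1 / d)
    ((div_lt_iff₀' hd).2 hdb)
  refine ⟨C / d, by positivity, fun ε hε => ?_⟩
  filter_upwards [h.eventually_le_integral_ite hpos hc₁ hc₂ hA hB hX hd hε,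
    eventually_gt_atTop 0] with x hx hx0
  rw [h.measureReal_lt_eq_integral_add d x]
  refine add_le_add hx ?_
  rw [← h.integral_ite_const]
  refine integral_mono ?_ (h.integrable_ite_stepSum (fun n => d * x < (n : ℝ)) x) fun ω => ?_
  · refine integrable_of_abs_le ((measurable_from_top : Measurable fun n : ℕ =>
      if d * x < (n : ℝ) then 1 - C / d / x else 0).comp h.measurable_X) |1 - C / d / x|
      fun ω => ?_
    split_ifs <;> simp
  · dsimp only
    split_ifs with hn
    · have hdx : 0 < d * x := by positivity
      have hn0 : (0 : ℝ) < X ω := hdx.trans hn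
      have h1 := hlow (X ω) (by exact_mod_cast hn0)
      have h2 : C / (X ω : ℝ) ≤ C / d / x := by
        rw [div_div]
        gcongr
      have hsub : {ω' | ∑ i ∈ Finset.range (X ω), (B i ω' : ℝ) ≤ X ω * (1 / d)}ᶜ ⊆
          {ω' | x < (stepSum A B (X ω) ω' : ℝ)} := by
        intro ω' hω'
        rw [Set.mem_compl_iff, Set.mem_ofPred_eq, not_le] at hω'
        rw [Set.mem_ofPred_eq, stepSum_cast]
        have h3 : x < X ω * (1 / d) := by
          rw [mul_one_div, lt_div_iff₀ hd, mul_comm]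
          exact hn
        have h4 : (0 : ℝ) ≤ A ω' := Nat.cast_nonneg _
        linarith
      have h5 := measureReal_mono (μ := P) hsub
      rw [probReal_compl_eq_one_sub
        (measurableSet_le (h.measurable_sum_B _) measurable_const)] at h5
      linarith
    · exact le_rfl

end IsFixedPoint

end StepTail

/-! ### Asymptotic relations -/

section Asymp

theorem asympLE_of_forall_eps {f g : ℝ → ℝ} (hg : ∀ᶠ x in atTop, 0 < g x)
    (h : ∀ ε > 0, ∀ᶠ x in atTop, f x ≤ (1 + ε) * g x) : AsympLE f g := by
  have := (ratioLimsup_le_iff hg 1).2 h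
  rwa [EReal.coe_one] at this

theorem asympGE_of_forall_eps {f g : ℝ → ℝ} (hg : ∀ᶠ x in atTop, 0 < g x)
    (h : ∀ ε > 0, ∀ᶠ x in atTop, (1 - ε) * g x ≤ f x) : AsympGE f g := by
  have := (le_ratioLiminf_iff hg 1).2 h
  rwa [EReal.coe_one] at this

/-- Squeeze with a parameter: `f` is compared with `u d` for `d` on either side of the critical
value, and `u d` approximates `g`. Two factors `1 ± δ` are composed, hence `δ ≤ ε / 2` below and `δ
≤ ε / 3` above, with `δ ≤ 1`. -/
theorem asympEq_of_approx {f g : ℝ → ℝ} {u : ℝ → ℝ → ℝ} (hg : ∀ᶠ x in atTop, 0 < g x)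
    {s t : Set ℝ}
    (hu : ∀ d ∈ s, ∀ ε > 0, ∀ᶠ x in atTop, f x ≤ (1 + ε) * u d x)
    (hl : ∀ d ∈ t, ∀ ε > 0, ∀ᶠ x in atTop, (1 - ε) * u d x ≤ f x)
    (hs : ∀ ε > 0, ∃ d ∈ s, ∀ᶠ x in atTop, u d x ≤ (1 + ε) * g x)
    (ht : ∀ ε > 0, ∃ d ∈ t, ∀ᶠ x in atTop, (1 - ε) * g x ≤ u d x) : AsympEq f g := by
  refine (tendsto_div_iff_forall_eps hg 1).2 ⟨fun ε hε => ?_, fun ε hε => ?_⟩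
  · obtain ⟨δ, hδ⟩ : ∃ δ, δ = min 1 (ε / 2) := ⟨_, rfl⟩
    have h0 : 0 < δ := by rw [hδ]; positivity
    have h1 : δ ≤ 1 := hδ ▸ min_le_left _ _
    have h2 : δ ≤ ε / 2 := hδ ▸ min_le_right _ _
    obtain ⟨d, hd, hd'⟩ := ht δ h0
    filter_upwards [hl d hd δ h0, hd', hg] with x h3 h4 h5
    calc (1 - ε) * g x ≤ (1 - δ) * (1 - δ) * g x := by
          gcongr
          nlinarith
      _ ≤ (1 - δ) * u d x := by
          rw [mul_assoc]
          gcongr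
      _ ≤ f x := h3
  · obtain ⟨δ, hδ⟩ : ∃ δ, δ = min 1 (ε / 3) := ⟨_, rfl⟩
    have h0 : 0 < δ := by rw [hδ]; positivity
    have h1 : δ ≤ 1 := hδ ▸ min_le_left _ _
    have h2 : δ ≤ ε / 3 := hδ ▸ min_le_right _ _
    obtain ⟨d, hd, hd'⟩ := hs δ h0
    filter_upwards [hu d hd δ h0, hd', hg] with x h3 h4 h5
    calc f x ≤ (1 + δ) * u d x := h3
      _ ≤ (1 + δ) * ((1 + δ) * g x) := by gcongr
      _ ≤ (1 + ε) * g x := by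
          rw [← mul_assoc]
          gcongr
          nlinarith

theorem AsympEq.comp_mul_le {f g : ℝ → ℝ} (hg : ∀ᶠ x in atTop, 0 < g x) (hfg : AsympEq f g)
    {y p : ℝ} (hy : 0 < y) (hp : 0 ≤ p)
    (h : ∀ ε > 0, ∀ᶠ x in atTop, g (y * x) ≤ (p + ε) * g x) :
    ∀ ε > 0, ∀ᶠ x in atTop, f (y * x) ≤ (p + ε) * f x := by
  intro ε hε
  obtain ⟨hl, hu⟩ := (tendsto_div_iff_forall_eps hg 1).1 hfg
  obtain ⟨δ, hδ0, hδ⟩ : ∃ δ > 0, (1 + δ) * (p + δ) < (p + ε) * (1 - δ) := by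
    have h1 : Tendsto (fun δ : ℝ => (p + ε) * (1 - δ) - (1 + δ) * (p + δ)) (𝓝[>] 0)
        (𝓝 ((p + ε) * (1 - 0) - (1 + 0) * (p + 0))) :=
      (Continuous.tendsto (by fun_prop) 0).mono_left nhdsWithin_le_nhds
    obtain ⟨δ, h2, h3⟩ := ((h1.eventually (lt_mem_nhds (show (0 : ℝ) < _ by linarith))).and
      self_mem_nhdsWithin).exists
    exact ⟨δ, h3, by linarith⟩
  have hmul : Tendsto (fun x : ℝ => y * x) atTop atTop := tendsto_id.const_mul_atTop hy
  filter_upwards [hmul.eventually (hu δ hδ0), hl δ hδ0, h δ hδ0, hg] with x h1 h2 h3 h4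
  calc f (y * x) ≤ (1 + δ) * g (y * x) := h1
    _ ≤ (1 + δ) * ((p + δ) * g x) := by gcongr
    _ ≤ (p + ε) * (1 - δ) * g x := by
      rw [← mul_assoc]
      gcongr
    _ ≤ (p + ε) * f x := by
      rw [mul_assoc]
      gcongr

theorem AsympEq.le_comp_mul {f g : ℝ → ℝ} (hg : ∀ᶠ x in atTop, 0 < g x) (hf : ∀ x, 0 ≤ f x)
    (hfg : AsympEq f g) {y p : ℝ} (hy : 0 < y)
    (h : ∀ ε > 0, ∀ᶠ x in atTop, (p - ε) * g x ≤ g (y * x)) :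
    ∀ ε > 0, ∀ᶠ x in atTop, (p - ε) * f x ≤ f (y * x) := by
  intro ε hε
  -- For `p ≤ ε` the left side is nonpositive; otherwise the coefficient is positive and
  -- inequalities may be multiplied by it.
  rcases le_or_gt p ε with hpε | hpε
  · exact Eventually.of_forall fun x =>
      (mul_nonpos_of_nonpos_of_nonneg (by linarith) (hf x)).trans (hf _)
  obtain ⟨hl, hu⟩ := (tendsto_div_iff_forall_eps hg 1).1 hfg
  obtain ⟨δ, hδ0, hδ1, hδ⟩ : ∃ δ > 0, δ < 1 ∧ (p - ε) * (1 + δ) < (1 - δ) * (p - δ) := by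
    have h1 : Tendsto (fun δ : ℝ => (1 - δ) * (p - δ) - (p - ε) * (1 + δ)) (𝓝[>] 0)
        (𝓝 ((1 - 0) * (p - 0) - (p - ε) * (1 + 0))) :=
      (Continuous.tendsto (by fun_prop) 0).mono_left nhdsWithin_le_nhds
    obtain ⟨δ, ⟨h2, h3⟩, h4⟩ := (((h1.eventually (lt_mem_nhds (show (0 : ℝ) < _ by linarith))).and
      (mem_nhdsWithin_of_mem_nhds (gt_mem_nhds one_pos))).and self_mem_nhdsWithin).exists
    exact ⟨δ, h4, h3, by linarith⟩
  have hmul : Tendsto (fun x : ℝ => y * x) atTop atTop := tendsto_id.const_mul_atTop hy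
  filter_upwards [hmul.eventually (hl δ hδ0), hu δ hδ0, h δ hδ0, hg] with x h1 h2 h3 h4
  calc (p - ε) * f x ≤ (p - ε) * ((1 + δ) * g x) := by
        gcongr
    _ ≤ (1 - δ) * (p - δ) * g x := by
        rw [← mul_assoc]
        gcongr
    _ ≤ (1 - δ) * g (y * x) := by
        rw [mul_assoc]
        gcongr
    _ ≤ f (y * x) := h1

end Asymp

/-! ### Extended regular variation -/

section ERV

variable {G : Measure ℝ} [IsProbabilityMeasure G]

/-- Extended regular variation with given exponents, in epsilon form. -/
def HasERVBounds (G : Measure ℝ) (αp αm : ℝ) : Prop :=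
  ∀ y : ℝ, 1 ≤ y →
    (∀ ε > 0, ∀ᶠ x in atTop, (y ^ (-αm) - ε) * tail G x ≤ tail G (y * x)) ∧
    (∀ ε > 0, ∀ᶠ x in atTop, tail G (y * x) ≤ (y ^ (-αp) + ε) * tail G x)

omit [IsProbabilityMeasure G] in
theorem isERV_iff (hpos : ∀ᶠ x in atTop, 0 < tail G x) :
    IsERV G ↔ ∃ αp αm : ℝ, 0 < αp ∧ 0 < αm ∧ HasERVBounds G αp αm := by
  simp only [IsERV, HasERVBounds, le_ratioLiminf_iff hpos, ratioLimsup_le_iff hpos]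

omit [IsProbabilityMeasure G] in
theorem HasERVBounds.isDominantlyVarying (hpos : ∀ x, 0 < tail G x) {αp αm : ℝ}
    (h : HasERVBounds G αp αm) : IsDominantlyVarying G := by
  refine ⟨2, one_lt_two, lt_of_lt_of_le ?_
    ((le_ratioLiminf_iff (Eventually.of_forall hpos) ((2 : ℝ) ^ (-αm))).2 (h 2 one_le_two).1)⟩
  exact_mod_cast Real.rpow_pos_of_pos two_pos _

omit [IsProbabilityMeasure G] in
theorem HasERVBounds.exists_forall_ge (hpos : ∀ x, 0 < tail G x) {αp αm : ℝ}
    (h : HasERVBounds G αp αm) {ε : ℝ} (hε : 0 < ε) :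
    ∃ y > 1, ∀ᶠ x in atTop, (1 - ε) * tail G x ≤ tail G (y * x) := by
  have h1 : Tendsto (fun y : ℝ => y ^ (-αm)) (𝓝[>] 1) (𝓝 1) := by
    have := (Real.continuousAt_rpow_const (1 : ℝ) (-αm) (Or.inl one_ne_zero)).tendsto
    rw [Real.one_rpow] at this
    exact this.mono_left nhdsWithin_le_nhds
  obtain ⟨y, h2, h3⟩ := ((h1.eventually (lt_mem_nhds (show 1 - ε / 2 < 1 by linarith))).and
    self_mem_nhdsWithin).exists
  refine ⟨y, h3, ?_⟩
  filter_upwards [(h y (le_of_lt h3)).1 (ε / 2) (by positivity)] with x hx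
  refine le_trans ?_ hx
  exact mul_le_mul_of_nonneg_right (by linarith) (hpos x).le

/-- A shift by `t ≥ 0` is eventually smaller than scaling by any `y > 1`, and scaling by `y` near
`1` hardly changes the tail. Negative shifts follow by taking reciprocals. -/
theorem HasERVBounds.isLongTailed (hpos : ∀ x, 0 < tail G x) {αp αm : ℝ}
    (h : HasERVBounds G αp αm) : IsLongTailed G := by
  have hnn : ∀ t : ℝ, 0 ≤ t → AsympEq (fun x => tail G (x + t)) (tail G) := by
    intro t ht
    refine (tendsto_div_iff_forall_eps (Eventually.of_forall hpos) 1).2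
      ⟨fun ε hε => ?_, fun ε hε => Eventually.of_forall fun x => ?_⟩
    · obtain ⟨y, hy, hy'⟩ := h.exists_forall_ge hpos hε
      have hy1 : 0 < y - 1 := by linarith
      filter_upwards [hy', eventually_ge_atTop (t / (y - 1))] with x hx hx'
      refine hx.trans (tail_antitone ?_)
      rw [div_le_iff₀ hy1] at hx'
      linarith
    · have h1 : tail G (x + t) ≤ tail G x := tail_antitone (by linarith)
      have h2 := mul_pos hε.lt (hpos x)
      linarith
  intro t
  rcases le_total 0 t with ht | ht
  · exact hnn t ht
  · have h1 := ((hnn (-t) (by linarith)).comp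
      (tendsto_atTop_add_const_right atTop t tendsto_id)).inv₀ one_ne_zero
    rw [inv_one] at h1
    refine h1.congr fun x => ?_
    simp [inv_div]

omit [IsProbabilityMeasure G] in
-- Any `q` strictly between `c ^ (-αp)` and `1` works, here the midpoint. This makes the remainders
-- of `T_c x / tail G x` small uniformly in large `x`.
theorem HasERVBounds.exists_geometric_bound {αp αm : ℝ} (hαp : 0 < αp) (h : HasERVBounds G αp αm) {c : ℝ} (hc : 1 < c) :
    ∃ q x₀ : ℝ, 0 < q ∧ q < 1 ∧ 0 < x₀ ∧
      ∀ x, x₀ ≤ x → ∀ n : ℕ, tail G (c ^ n * x) ≤ q ^ n * tail G x := by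
  have hlt : c ^ (-αp) < 1 := Real.rpow_lt_one_of_one_lt_of_neg hc (by linarith)
  have hgt : 0 < c ^ (-αp) := Real.rpow_pos_of_pos (by linarith) _
  obtain ⟨x₁, hx₁⟩ := eventually_atTop.1
    ((h c hc.le).2 ((1 - c ^ (-αp)) / 2) (by linarith))
  refine ⟨(1 + c ^ (-αp)) / 2, max x₁ 1, by linarith, by linarith, by positivity,
    fun x hx n => ?_⟩
  have hx0 : 0 ≤ x := zero_le_one.trans ((le_max_right _ _).trans hx)
  induction n with
  | zero => simp
  | succ n ih =>
    have h1 := hx₁ (c ^ n * x) (((le_max_left _ _).trans hx).trans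
      (le_mul_of_one_le_left hx0 (one_le_pow₀ hc.le)))
    rw [← mul_assoc, ← pow_succ'] at h1
    calc tail G (c ^ (n + 1) * x) ≤ _ := h1
      _ = (1 + c ^ (-αp)) / 2 * tail G (c ^ n * x) := by ring
      _ ≤ (1 + c ^ (-αp)) / 2 * (((1 + c ^ (-αp)) / 2) ^ n * tail G x) := by gcongr
      _ = _ := by ring

omit [IsProbabilityMeasure G] in
theorem tail_le_geomTailSum {c x : ℝ} (hsum : Summable fun n : ℕ => tail G (c ^ n * x)) :
    tail G x ≤ geomTailSum G c x := by
  have h := hsum.le_tsum 0 fun n _ => tail_nonneg G _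
  rwa [pow_zero, one_mul] at h

/-- For extended regularly varying tails, `c ↦ T_c` is asymptotically continuous. -/
theorem HasERVBounds.exists_geomTailSum_le (hpos : ∀ x, 0 < tail G x)
    (hsum : ∀ c x : ℝ, 1 < c → 0 < x → Summable fun n : ℕ => tail G (c ^ n * x)) {αp αm : ℝ}
    (hαp : 0 < αp) (h : HasERVBounds G αp αm) {c₁ : ℝ} (hc₁ : 1 < c₁) {ε : ℝ} (hε : 0 < ε) :
    ∃ r > 1, ∀ c c' : ℝ, c₁ ≤ c → c ≤ c' → c' ≤ r * c →
      ∀ᶠ x in atTop, geomTailSum G c x ≤ (1 + ε) * geomTailSum G c' x := by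
  -- The series is cut at `N`: terms from `N` on total at most `ε / 2 * tail G x`, and in the first
  -- `N` terms passing from `c` to `c'` stretches arguments by at most `r ^ N < μ`. Taking `q` at
  -- the lower limit `c₁` makes `r` independent of `c`.
  obtain ⟨q, x₀, hq0, hq1, hx₀, hq⟩ := h.exists_geometric_bound hαp hc₁
  obtain ⟨N, hN⟩ : ∃ N : ℕ, q ^ N / (1 - q) < ε / 2 := by
    have h1 := (tendsto_pow_atTop_nhds_zero_of_lt_one hq0.le hq1).div_const (1 - q)
    rw [zero_div] at h1
    exact (h1.eventually (gt_mem_nhds (by positivity))).exists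
  obtain ⟨μ, hμ, hμ'⟩ := h.exists_forall_ge hpos (ε := 1 - 1 / (1 + ε / 2))
    (by rw [sub_pos, div_lt_one (by positivity)]; linarith)
  obtain ⟨x₁, hx₁⟩ := eventually_atTop.1 hμ'
  obtain ⟨r, hr, hr'⟩ : ∃ r > 1, r ^ N < μ := by
    have h1 : Tendsto (fun r : ℝ => r ^ N) (𝓝[>] 1) (𝓝 (1 ^ N)) :=
      (Continuous.tendsto (by fun_prop) 1).mono_left nhdsWithin_le_nhds
    obtain ⟨r, h2, h3⟩ := ((h1.eventually (gt_mem_nhds (by simpa using hμ))).and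
      self_mem_nhdsWithin).exists
    exact ⟨r, h3, h2⟩
  refine ⟨r, hr, fun c c' hc hcc' hc' => ?_⟩
  have hc1 : 1 < c := hc₁.trans_le hc
  have hc0 : 0 < c := by linarith
  filter_upwards [eventually_ge_atTop x₀, eventually_ge_atTop x₁] with x hx hx'
  have hx0 : 0 < x := hx₀.trans_le hx
  have hs := hsum c x hc1 hx0
  have hs' := hsum c' x (hc1.trans_le hcc') hx0
  have hhead : ∀ n ∈ Finset.range N, tail G (c ^ n * x) ≤ (1 + ε / 2) * tail G (c' ^ n * x) := by
    intro n hn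
    have h1 := hx₁ (c ^ n * x) (hx'.trans (le_mul_of_one_le_left hx0.le (one_le_pow₀ hc1.le)))
    have h2 : c' ^ n * x ≤ μ * (c ^ n * x) := by
      calc c' ^ n * x ≤ (r * c) ^ n * x := by
            have : 0 ≤ c' := by linarith
            gcongr
        _ = r ^ n * (c ^ n * x) := by rw [mul_pow, mul_assoc]
        _ ≤ r ^ N * (c ^ n * x) := by
            gcongr
            · exact hr.le
            · exact (Finset.mem_range.1 hn).le
        _ ≤ _ := by gcongr
    have h3 := h1.trans (tail_antitone h2)
    rw [sub_sub_cancel, one_div_mul_eq_div, div_le_iff₀ (by positivity)] at h3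
    linarith
  have htail : ∑' n : ℕ, tail G (c ^ (n + N) * x) ≤ ε / 2 * tail G x := by
    have hgeo : Summable fun n : ℕ => q ^ n * (q ^ N * tail G x) :=
      (summable_geometric_of_lt_one hq0.le hq1).mul_right _
    calc _ ≤ ∑' n : ℕ, q ^ n * (q ^ N * tail G x) := by
          refine ((summable_nat_add_iff N).2 hs).tsum_le_tsum (fun n => ?_) hgeo
          calc tail G (c ^ (n + N) * x) ≤ tail G (c₁ ^ (n + N) * x) :=
                tail_antitone (by gcongr)
            _ ≤ q ^ (n + N) * tail G x := hq x hx _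
            _ = _ := by rw [pow_add, mul_assoc]
      _ = q ^ N / (1 - q) * tail G x := by
          rw [tsum_mul_right, tsum_geometric_of_lt_one hq0.le hq1]
          ring
      _ ≤ _ := by
          gcongr
          exact (hpos x).le
  have hle := tail_le_geomTailSum hs'
  calc geomTailSum G c x
      = ∑ n ∈ Finset.range N, tail G (c ^ n * x) + ∑' n : ℕ, tail G (c ^ (n + N) * x) :=
        (hs.sum_add_tsum_nat_add N).symm
    _ ≤ (1 + ε / 2) * ∑ n ∈ Finset.range N, tail G (c' ^ n * x) + ε / 2 * tail G x := by
        rw [Finset.mul_sum]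
        exact add_le_add (Finset.sum_le_sum hhead) htail
    _ ≤ (1 + ε / 2) * geomTailSum G c' x + ε / 2 * geomTailSum G c' x := by
        gcongr
        exact hs'.sum_le_tsum _ fun n _ => tail_nonneg G _
    _ = _ := by ring

omit [IsProbabilityMeasure G] in
theorem HasERVBounds.geomTailSum_bounds
    (hsum : ∀ c x : ℝ, 1 < c → 0 < x → Summable fun n : ℕ => tail G (c ^ n * x)) {αp αm : ℝ}
    (h : HasERVBounds G αp αm) {c : ℝ} (hc : 1 < c) {y : ℝ} (hy : 1 ≤ y) :
    (∀ ε > 0, ∀ᶠ x in atTop, (y ^ (-αm) - ε) * geomTailSum G c x ≤ geomTailSum G c (y * x)) ∧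
    (∀ ε > 0, ∀ᶠ x in atTop, geomTailSum G c (y * x) ≤ (y ^ (-αp) + ε) * geomTailSum G c x) := by
  have hy0 : 0 < y := by linarith
  have hcomm : ∀ (n : ℕ) (x : ℝ), c ^ n * (y * x) = y * (c ^ n * x) := fun n x => by ring
  refine ⟨fun ε hε => ?_, fun ε hε => ?_⟩
  · obtain ⟨x₁, hx₁⟩ := eventually_atTop.1 ((h y hy).1 ε hε)
    filter_upwards [eventually_ge_atTop x₁, eventually_gt_atTop 0] with x hx hx0
    rw [geomTailSum, geomTailSum, ← tsum_mul_left]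
    refine ((hsum c x hc hx0).mul_left _).tsum_le_tsum (fun n => ?_)
      (hsum c (y * x) hc (by positivity))
    rw [hcomm]
    exact hx₁ _ (hx.trans (le_mul_of_one_le_left hx0.le (one_le_pow₀ hc.le)))
  · obtain ⟨x₁, hx₁⟩ := eventually_atTop.1 ((h y hy).2 ε hε)
    filter_upwards [eventually_ge_atTop x₁, eventually_gt_atTop 0] with x hx hx0
    rw [geomTailSum, geomTailSum, ← tsum_mul_left]
    refine (hsum c (y * x) hc (by positivity)).tsum_le_tsum (fun n => ?_)
      ((hsum c x hc hx0).mul_left _)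
    rw [hcomm]
    exact hx₁ _ (hx.trans (le_mul_of_one_le_left hx0.le (one_le_pow₀ hc.le)))

omit [IsProbabilityMeasure G] in
/-- Extended regular variation passes from `G` to distributions with tail asymptotic to a multiple
of `T_c`. -/
theorem HasERVBounds.of_asympEq_geomTailSum (hpos : ∀ x, 0 < tail G x)
    (hsum : ∀ c x : ℝ, 1 < c → 0 < x → Summable fun n : ℕ => tail G (c ^ n * x)) {αp αm : ℝ}
    (h : HasERVBounds G αp αm) {c D : ℝ} (hc : 1 < c) (hD : 0 < D) {H : Measure ℝ}
    (hH : AsympEq (tail H) fun x => D * geomTailSum G c x) : HasERVBounds H αp αm := by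
  have hT : ∀ᶠ x in atTop, 0 < D * geomTailSum G c x := by
    filter_upwards [eventually_gt_atTop 0] with x hx
    exact mul_pos hD ((hpos x).trans_le (tail_le_geomTailSum (hsum c x hc hx)))
  intro y hy
  have hy0 : 0 < y := by linarith
  obtain ⟨h1, h2⟩ := h.geomTailSum_bounds hsum hc hy
  refine ⟨hH.le_comp_mul hT (tail_nonneg H) hy0 fun ε hε => ?_,
    hH.comp_mul_le hT hy0 (Real.rpow_nonneg hy0.le _) fun ε hε => ?_⟩
  · filter_upwards [h1 ε hε] with x hx
    rw [mul_left_comm]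
    gcongr
  · filter_upwards [h2 ε hε] with x hx
    rw [mul_left_comm]
    gcongr

end ERV

/-! ### Regular variation -/

section RV

variable {G : Measure ℝ}

theorem IsRV.tendsto_tail_div (hpos : ∀ x, 0 < tail G x) {α : ℝ} (h : IsRV G α) {y : ℝ}
    (hy : 1 ≤ y) : Tendsto (fun x => tail G (y * x) / tail G x) atTop (𝓝 (y ^ (-α))) := by
  obtain ⟨-, L, hL, hG⟩ := h
  rcases hy.eq_or_lt with rfl | hy1
  · simp only [one_mul, Real.one_rpow]
    exact tendsto_const_nhds.congr fun x => (div_self (hpos x).ne').symm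
  · have h1 := (hL y hy1).const_mul (y ^ (-α))
    rw [mul_one] at h1
    refine h1.congr' ?_
    filter_upwards [eventually_gt_atTop 0] with x hx
    have hy0 : 0 < y := by linarith
    rw [hG (y * x) (by positivity), hG x hx, Real.mul_rpow hy0.le hx.le]
    have := (Real.rpow_pos_of_pos hx (-α)).ne'
    field_simp

theorem isRV_of_tendsto_tail_div {α : ℝ} (hα : 0 < α)
    (h : ∀ y, 1 < y → Tendsto (fun x => tail G (y * x) / tail G x) atTop (𝓝 (y ^ (-α)))) :
    IsRV G α := by
  refine ⟨hα, fun x => x ^ α * tail G x, fun y hy => ?_, fun x hx => ?_⟩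
  · have hy0 : 0 < y := by linarith
    have h1 := (h y hy).const_mul (y ^ α)
    rw [← Real.rpow_add hy0, add_neg_cancel, Real.rpow_zero] at h1
    refine h1.congr' ?_
    filter_upwards [eventually_gt_atTop 0] with x hx
    rw [Real.mul_rpow hy0.le hx.le]
    have := (Real.rpow_pos_of_pos hx α).ne'
    field_simp
  · rw [← mul_assoc, ← Real.rpow_add hx, neg_add_cancel, Real.rpow_zero, one_mul]

theorem IsRV.hasERVBounds (hpos : ∀ x, 0 < tail G x) {α : ℝ} (h : IsRV G α) :
    HasERVBounds G α α := fun _ hy =>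
  (tendsto_div_iff_forall_eps (Eventually.of_forall hpos) _).1 (h.tendsto_tail_div hpos hy)

/-- Dominated convergence for series: the `n`-th ratio tends to `(c ^ (-α)) ^ n` and is dominated by
`q ^ n`. -/
theorem IsRV.tendsto_geomTailSum_div [IsProbabilityMeasure G] (hpos : ∀ x, 0 < tail G x) {α : ℝ}
    (h : IsRV G α) {c : ℝ} (hc : 1 < c) :
    Tendsto (fun x => geomTailSum G c x / tail G x) atTop (𝓝 (1 - c ^ (-α))⁻¹) := by
  obtain ⟨q, x₀, hq0, hq1, -, hq⟩ := (h.hasERVBounds hpos).exists_geometric_bound h.1 hc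
  have hc0 : 0 < c := by linarith
  have h1 : Tendsto (fun x => ∑' n : ℕ, tail G (c ^ n * x) / tail G x) atTop
      (𝓝 (∑' n : ℕ, (c ^ (-α)) ^ n)) := by
    refine tendsto_tsum_of_dominated_convergence (summable_geometric_of_lt_one hq0.le hq1)
      (fun n => ?_) ?_
    · have := h.tendsto_tail_div hpos (one_le_pow₀ (n := n) hc.le)
      rwa [← Real.rpow_natCast, ← Real.rpow_mul hc0.le, mul_comm, Real.rpow_mul hc0.le,
        Real.rpow_natCast, Real.rpow_natCast] at this
    · filter_upwards [eventually_ge_atTop x₀] with x hx n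
      rw [Real.norm_of_nonneg (div_nonneg (tail_nonneg _ _) (hpos x).le), div_le_iff₀ (hpos x)]
      exact hq x hx n
  rw [tsum_geometric_of_lt_one (Real.rpow_nonneg hc0.le _)
    (Real.rpow_lt_one_of_one_lt_of_neg hc (by linarith [h.1]))] at h1
  refine h1.congr fun x => ?_
  rw [geomTailSum, tsum_div_const]

theorem AsympEq.tendsto_comp_mul_div {f g : ℝ → ℝ} (hg : ∀ᶠ x in atTop, g x ≠ 0)
    (hfg : AsympEq f g) {y p : ℝ} (hy : 0 < y)
    (h : Tendsto (fun x => g (y * x) / g x) atTop (𝓝 p)) :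
    Tendsto (fun x => f (y * x) / f x) atTop (𝓝 p) := by
  have hmul : Tendsto (fun x : ℝ => y * x) atTop atTop := tendsto_id.const_mul_atTop hy
  have h1 := ((hfg.comp hmul).mul h).mul (hfg.inv₀ one_ne_zero)
  rw [one_mul, inv_one, mul_one] at h1
  refine h1.congr' ?_
  filter_upwards [hg, hmul.eventually hg] with x h2 h3
  simp only [Function.comp_apply, inv_div]
  field_simp

end RV

/-! ### The reference distribution -/

section Reference

variable {Ω : Type*} [MeasurableSpace Ω] {P : Measure Ω} {G : Measure ℝ} [IsProbabilityMeasure G]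
  {U V : Ω → ℝ} {u v : ℝ}

/-- A tail vanishing somewhere vanishes from there on; division by zero then gives quotients `0`, so
`u = v = 0`. -/
theorem tail_pos_of_tendsto_div (huv : 0 < u + v)
    (hU : Tendsto (fun x => P.real {ω | x < U ω} / tail G x) atTop (𝓝 u))
    (hV : Tendsto (fun x => P.real {ω | x < V ω} / tail G x) atTop (𝓝 v)) (x : ℝ) :
    0 < tail G x := by
  by_contra! hx
  have h0 : ∀ᶠ y in atTop, tail G y = 0 := by
    filter_upwards [eventually_ge_atTop x] with y hy
    exact le_antisymm ((tail_antitone hy).trans hx) (tail_nonneg _ _)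
  have h1 : u = 0 := tendsto_nhds_unique hU
    (tendsto_const_nhds.congr' (h0.mono fun y hy => by simp [hy]))
  have h2 : v = 0 := tendsto_nhds_unique hV
    (tendsto_const_nhds.congr' (h0.mono fun y hy => by simp [hy]))
  linarith

theorem mul_measureReal_lt_le_integral (hU0 : ∀ ω, 0 ≤ U ω) (hU : Integrable U P)
    [IsProbabilityMeasure P] {x : ℝ} (hx : 0 ≤ x) : x * P.real {ω | x < U ω} ≤ ∫ ω, U ω ∂P := by
  refine le_trans ?_ (mul_meas_ge_le_integral_of_nonneg (ae_of_all _ hU0) hU x)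
  exact mul_le_mul_of_nonneg_left
    (measureReal_mono fun ω (hω : x < U ω) => show x ≤ U ω from hω.le) hx

/-- Markov's inequality for `U` and `V` gives `tail G y = O(1 / y)`, which is summable along a
geometric sequence. -/
theorem summable_tail_geometric [IsProbabilityMeasure P] (huv : 0 < u + v)
    (hU0 : ∀ ω, 0 ≤ U ω) (hV0 : ∀ ω, 0 ≤ V ω) (hUint : Integrable U P) (hVint : Integrable V P)
    (hU : Tendsto (fun x => P.real {ω | x < U ω} / tail G x) atTop (𝓝 u))
    (hV : Tendsto (fun x => P.real {ω | x < V ω} / tail G x) atTop (𝓝 v)) {c x : ℝ}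
    (hc : 1 < c) (hx : 0 < x) : Summable fun n : ℕ => tail G (c ^ n * x) := by
  have hpos := tail_pos_of_tendsto_div huv hU hV
  obtain ⟨M, hM⟩ : ∃ M, M = (∫ ω, U ω ∂P) + ∫ ω, V ω ∂P := ⟨_, rfl⟩
  have hbound : ∀ᶠ y in atTop, tail G y ≤ 2 / (u + v) * (M / y) := by
    filter_upwards [(hU.add hV).eventually (lt_mem_nhds (half_lt_self huv)),
      eventually_gt_atTop 0] with y hy hy0
    rw [← add_div, lt_div_iff₀ (hpos y)] at hy
    have h1 := mul_measureReal_lt_le_integral hU0 hUint hy0.le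
    have h2 := mul_measureReal_lt_le_integral hV0 hVint hy0.le
    have h3 : (u + v) / 2 * tail G y ≤ M / y := by
      rw [le_div_iff₀ hy0]
      nlinarith
    calc tail G y = 2 / (u + v) * ((u + v) / 2 * tail G y) := by field_simp
      _ ≤ _ := by gcongr
  have hlim : Tendsto (fun n : ℕ => c ^ n * x) atTop atTop :=
    (tendsto_pow_atTop_atTop_of_one_lt hc).atTop_mul_const hx
  have hgeo : Summable fun n : ℕ => c⁻¹ ^ n * (2 / (u + v) * (M / x)) :=
    (summable_geometric_of_lt_one (by positivity) (inv_lt_one_of_one_lt₀ hc)).mul_right _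
  refine Summable.of_norm_bounded_eventually_nat hgeo ?_
  filter_upwards [hlim.eventually hbound] with n hn
  rw [Real.norm_of_nonneg (tail_nonneg _ _)]
  refine hn.trans (le_of_eq ?_)
  have : 0 < c := by linarith
  rw [inv_pow]
  field_simp

end Reference

end HeavyTail

/-! ### Assembly: from the one-step inequalities to the asymptotics of `P(X > x)`. -/

theorem mainTheorem1 {Ω : Type*} [MeasurableSpace Ω] (P : Measure Ω) [IsProbabilityMeasure P]
    (A : Ω → ℕ) (B : ℕ → Ω → ℕ) (X : Ω → ℕ) (hX : IsFixedPoint P A B X)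
    (hA0_pos : 0 < P.real {ω | A ω = 0}) (hA0_lt : P.real {ω | A ω = 0} < 1)
    (hB0_lt : P.real {ω | B 0 ω = 0} < 1)
    (a b : ℝ)
    (hA_int : Integrable (fun ω => (A ω : ℝ)) P) (ha : a = ∫ ω, (A ω : ℝ) ∂P)
    (hB_int : Integrable (fun ω => (B 0 ω : ℝ)) P) (hb : b = ∫ ω, (B 0 ω : ℝ) ∂P)
    (hb_pos : 0 < b) (hb_lt : b < 1)
    (G : Measure ℝ) [IsProbabilityMeasure G]
    (c₁ c₂ : ℝ) (hc₁ : 0 ≤ c₁) (hc₂ : 0 ≤ c₂) (hc : 0 < c₁ + c₂)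
    (hA_tail : Tendsto (fun x : ℝ => P.real {ω | x < (A ω : ℝ)} / tail G x) atTop (𝓝 c₁))
    (hB_tail : Tendsto (fun x : ℝ => P.real {ω | x < (B 0 ω : ℝ)} / tail G x) atTop (𝓝 c₂))
    (D : ℝ) (hD : D = ((1 - b) * c₁ + a * c₂) / (1 - b)) :
    -- the series defining `T_c(x)` converges
    (∀ c x : ℝ, 1 < c → 0 < x → Summable (fun n : ℕ => tail G (c ^ n * x))) ∧
    -- lower bound
    (IsStrongSubexponential G → ∀ d : ℝ, 1 / b < d →
      AsympGE (fun x => P.real {ω | x < (X ω : ℝ)}) (fun x => D * geomTailSum G d x)) ∧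
    -- upper bound
    (IsDominantlyVarying G → IsLongTailed G → ∀ d : ℝ, 1 < d → d < 1 / b →
      AsympLE (fun x => P.real {ω | x < (X ω : ℝ)}) (fun x => D * geomTailSum G d x)) ∧
    -- exact asymptotics
    (IsDominantlyVarying G → IsLongTailed G → GeomTailSumContinuousAt G (1 / b) →
      AsympEq (fun x => P.real {ω | x < (X ω : ℝ)}) (fun x => D * geomTailSum G (1 / b) x)) ∧
    -- extended regular variation
    (IsERV G →
      AsympEq (fun x => P.real {ω | x < (X ω : ℝ)}) (fun x => D * geomTailSum G (1 / b) x) ∧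
      IsERV (P.map (fun ω => (X ω : ℝ)))) ∧
    -- regular variation
    (∀ α : ℝ, IsRV G α →
      IsRV (P.map (fun ω => (X ω : ℝ))) α ∧
      AsympEq (fun x => P.real {ω | x < (X ω : ℝ)})
        (fun x => ((1 - b) * c₁ + a * c₂) / ((1 - b) * (1 - b ^ α)) * tail G x)) := by
  have hG : ∀ x, 0 < tail G x := tail_pos_of_tendsto_div hc hA_tail hB_tail
  have hsum : ∀ c x : ℝ, 1 < c → 0 < x → Summable (fun n : ℕ => tail G (c ^ n * x)) :=
    fun c x h1 hx => summable_tail_geometric hc (fun ω => Nat.cast_nonneg _)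
      (fun ω => Nat.cast_nonneg _) hA_int hB_int hA_tail hB_tail h1 hx
  obtain ⟨hAl, hAu⟩ := (tendsto_div_iff_forall_eps (Eventually.of_forall hG) c₁).1 hA_tail
  obtain ⟨hBl, hBu⟩ := (tendsto_div_iff_forall_eps (Eventually.of_forall hG) c₂).1 hB_tail
  have hX_int := hX.integrable_X hA_int hB_int (hb ▸ hb_lt)
  have h1b : 0 < 1 - b := by linarith
  -- Positivity of `a` ensures `D > 0` even when `c₁ = 0`.
  have ha_pos : 0 < a := by
    have hnn : ∀ ω, 0 ≤ (A ω : ℝ) := fun ω => Nat.cast_nonneg _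
    refine lt_of_le_of_ne (ha ▸ integral_nonneg hnn) fun h0 => ?_
    have h1 := (integral_eq_zero_iff_of_nonneg hnn hA_int).1 (ha.symm.trans h0.symm)
    have h2 : P.real {ω | A ω = 0} = 1 := by
      have h3 : {ω | A ω = 0} =ᵐ[P] Set.univ := by
        rw [eventuallyEq_univ]
        filter_upwards [h1] with ω hω
        exact Nat.cast_eq_zero.1 hω
      rw [measureReal_congr h3, probReal_univ]
    linarith
  have hD' : D = c₁ + (∫ ω, (X ω : ℝ) ∂P) * c₂ := by
    rw [hX.integral_X hA_int hB_int (hb ▸ hb_lt), ← ha, ← hb, hD]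
    field_simp
  have hD_pos : 0 < D := by
    rw [hD]
    have : 0 < (1 - b) * c₁ + a * c₂ := by
      rcases hc₁.eq_or_lt with h | h
      · have : 0 < c₂ := by linarith
        positivity
      · positivity
    positivity
  have hTpos : ∀ d, 1 < d → ∀ᶠ x in atTop, 0 < D * geomTailSum G d x := by
    intro d hd
    filter_upwards [eventually_gt_atTop 0] with x hx
    exact mul_pos hD_pos ((hG x).trans_le (tail_le_geomTailSum (hsum d x hd hx)))
  have hone : 1 < 1 / b := (one_lt_div hb_pos).2 hb_lt
  have hlower : ∀ d, 1 / b < d → ∀ ε > 0, ∀ᶠ x in atTop,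
      (1 - ε) * (D * geomTailSum G d x) ≤ P.real {ω | x < (X ω : ℝ)} := by
    intro d hd ε hε
    have hd1 : 1 < d := hone.trans hd
    rcases le_or_gt 1 ε with hε1 | hε1
    · filter_upwards [hTpos d hd1] with x hx
      exact (mul_nonpos_of_nonpos_of_nonneg (by linarith) hx.le).trans measureReal_nonneg
    obtain ⟨C, hC, hstep⟩ := hX.exists_eventually_le_measureReal_lt hG hc₁ hc₂ hB_int hAl hBl
      hX_int (d := d) (by linarith) (by rw [← hb]; exact (div_lt_iff₀ hb_pos).1 hd)
    -- Half of `ε` is spent on the one-step error, the other half on the accumulated factor `1 - C d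
    -- / ((d - 1) x)`.
    obtain ⟨x₁, hx₁⟩ := eventually_atTop.1 (hstep (D * ε / 2) (by positivity))
    rw [← hD'] at hx₁
    have hd0 : 0 < d - 1 := by linarith
    filter_upwards [eventually_ge_atTop (max x₁ 1), eventually_ge_atTop (C * d / (d - 1)),
      eventually_ge_atTop (C * d / (d - 1) / (ε / 2)), hTpos d hd1] with x h1 h2 h3 h4
    have hx0 : 0 < x := one_pos.trans_le ((le_max_right _ _).trans h1)
    have h5 := mul_tsum_le_of_add_le (F := fun x => P.real {ω | x < (X ω : ℝ)}) (g := tail G)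
      (c := D - D * ε / 2) hd1 (by nlinarith) hC.le (tail_nonneg G)
      (one_pos.trans_le (le_max_right x₁ 1)) (fun x => measureReal_nonneg)
      (fun x hx => hsum d x hd1 hx) (fun x hx => hx₁ x ((le_max_left _ _).trans hx)) h1 h2
    refine le_trans ?_ h5
    have h6 : C * d / (d - 1) / x ≤ ε / 2 := by
      rw [div_le_iff₀ (by positivity)] at h3
      rw [div_le_iff₀ hx0]
      linarith
    have h7 : 0 ≤ C * d / (d - 1) / x := by
      have : 0 < d := by linarith
      positivity
    calc (1 - ε) * (D * geomTailSum G d x)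
        ≤ (1 - C * d / (d - 1) / x) * (1 - ε / 2) * (D * geomTailSum G d x) := by
          gcongr
          nlinarith
      _ = _ := by
          rw [geomTailSum]
          ring
  have hupper : IsDominantlyVarying G → IsLongTailed G → ∀ d, 1 < d → d < 1 / b → ∀ ε > 0,
      ∀ᶠ x in atTop, P.real {ω | x < (X ω : ℝ)} ≤ (1 + ε) * (D * geomTailSum G d x) := by
    intro hDV hL d hd hd' ε hε
    have hstep := hX.eventually_measureReal_lt_le hG hDV hL hc₁ hc₂ hB_int hAu hBu hX_int
      (d := d) (by linarith) (by rw [← hb]; exact (lt_div_iff₀ hb_pos).1 hd') (mul_pos hD_pos hε)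
    rw [← hD'] at hstep
    obtain ⟨x₁, hx₁⟩ := eventually_atTop.1 hstep
    filter_upwards [eventually_ge_atTop (max x₁ 1)] with x h1
    have h2 := le_mul_tsum_of_le_add (F := fun x => P.real {ω | x < (X ω : ℝ)}) (g := tail G)
      hd (by positivity) (tail_nonneg G) (one_pos.trans_le (le_max_right x₁ 1))
      (tendsto_measureReal_lt_atTop hX.measurable_real_X) (fun x hx => hsum d x hd hx)
      (fun x hx => hx₁ x ((le_max_left _ _).trans hx)) h1
    refine h2.trans (le_of_eq ?_)
    rw [geomTailSum]
    ring
  have hexact : IsDominantlyVarying G → IsLongTailed G →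
      (∀ ε > 0, ∃ d ∈ Set.Ioo 1 (1 / b), ∀ᶠ x in atTop,
        geomTailSum G d x ≤ (1 + ε) * geomTailSum G (1 / b) x) →
      (∀ ε > 0, ∃ d ∈ Set.Ioi (1 / b), ∀ᶠ x in atTop,
        (1 - ε) * geomTailSum G (1 / b) x ≤ geomTailSum G d x) →
      AsympEq (fun x => P.real {ω | x < (X ω : ℝ)}) (fun x => D * geomTailSum G (1 / b) x) := by
    intro hDV hL hs ht
    refine asympEq_of_approx (u := fun d x => D * geomTailSum G d x)
      (s := Set.Ioo 1 (1 / b)) (t := Set.Ioi (1 / b)) (hTpos _ hone)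
      (fun d hd => hupper hDV hL d hd.1 hd.2) (fun d hd => hlower d hd)
      (fun ε hε => ?_) fun ε hε => ?_
    · obtain ⟨d, hd, h⟩ := hs ε hε
      refine ⟨d, hd, h.mono fun x hx => ?_⟩
      rw [mul_left_comm]
      gcongr
    · obtain ⟨d, hd, h⟩ := ht ε hε
      refine ⟨d, hd, h.mono fun x hx => ?_⟩
      rw [mul_left_comm]
      gcongr
  have herv : ∀ αp αm : ℝ, 0 < αp → HasERVBounds G αp αm →
      AsympEq (fun x => P.real {ω | x < (X ω : ℝ)})
        (fun x => D * geomTailSum G (1 / b) x) := by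
    intro αp αm hαp h
    refine hexact (h.isDominantlyVarying hG) (h.isLongTailed hG)
      (fun ε hε => ?_) fun ε hε => ?_
    -- A fixed `d₀ > 1` bounds `d` away from `1`, so that one ratio `r` serves all `d ≥ d₀`; then
    -- `d` is taken within a factor `r` of `1 / b`.
    · obtain ⟨d₀, hd₀, hd₀'⟩ := exists_between hone
      obtain ⟨r, hr, hr'⟩ := h.exists_geomTailSum_le hG hsum hαp hd₀ hε
      have h1 : 1 / b / r < 1 / b := div_lt_self (by positivity) hr
      refine ⟨max d₀ (1 / b / r), ⟨lt_max_of_lt_left hd₀, max_lt hd₀' h1⟩,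
        hr' _ _ (le_max_left _ _) (max_lt hd₀' h1).le ?_⟩
      calc 1 / b = r * (1 / b / r) := by field_simp
        _ ≤ _ := by
          gcongr
          exact le_max_right _ _
    · obtain ⟨r, hr, hr'⟩ := h.exists_geomTailSum_le hG hsum hαp hone hε
      have h1 : 1 / b < r * (1 / b) := lt_mul_of_one_lt_left (by positivity) hr
      refine ⟨r * (1 / b), h1, ?_⟩
      filter_upwards [hr' (1 / b) (r * (1 / b)) le_rfl h1.le le_rfl, hTpos _ (hone.trans h1)]
        with x hx hx'
      have h2 : 0 < geomTailSum G (r * (1 / b)) x := pos_of_mul_pos_right hx' hD_pos.le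
      rcases le_or_gt 1 ε with hε1 | hε1
      · have h3 : 0 ≤ geomTailSum G (1 / b) x := tsum_nonneg fun n => tail_nonneg G _
        nlinarith
      · calc _ ≤ (1 - ε) * ((1 + ε) * geomTailSum G (r * (1 / b)) x) := by
              gcongr
          _ ≤ _ := by nlinarith [mul_pos (mul_pos hε.lt hε.lt) h2]
  have hmap : (fun x => P.real {ω | x < (X ω : ℝ)}) = tail (P.map fun ω => (X ω : ℝ)) :=
    funext fun x => (tail_map hX.measurable_real_X x).symm
  refine ⟨hsum, fun _ d hd => ?_, fun hDV hL d hd hd' => ?_, fun hDV hL hcont => ?_,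
    fun hE => ?_, fun α hα => ?_⟩
  · exact asympGE_of_forall_eps (hTpos d (hone.trans hd)) (hlower d hd)
  · exact asympLE_of_forall_eps (hTpos d hd) (hupper hDV hL d hd hd')
  · have hT : ∀ᶠ x in atTop, 0 < geomTailSum G (1 / b) x :=
      (hTpos _ hone).mono fun x hx => pos_of_mul_pos_right hx hD_pos.le
    refine hexact hDV hL (fun ε hε => ?_) fun ε hε => ?_
    · have h1 : (1 : EReal) < ((1 + ε : ℝ) : EReal) := by
        exact_mod_cast lt_add_of_pos_right (1 : ℝ) hε
      obtain ⟨d, ⟨h2, h3⟩, h4⟩ := (((hcont.1.eventually (gt_mem_nhds h1)).and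
        (mem_nhdsWithin_of_mem_nhds (lt_mem_nhds hone))).and self_mem_nhdsWithin).exists
      refine ⟨d, ⟨h3, h4⟩, ?_⟩
      filter_upwards [eventually_lt_of_limsup_lt h2, hT] with x hx hx'
      exact (div_le_iff₀ hx').1 (EReal.coe_lt_coe_iff.1 hx).le
    · have h1 : ((1 - ε : ℝ) : EReal) < (1 : EReal) := by
        exact_mod_cast sub_lt_self (1 : ℝ) hε
      obtain ⟨d, h2, h4⟩ := ((hcont.2.eventually (lt_mem_nhds h1)).and
        self_mem_nhdsWithin).exists
      refine ⟨d, h4, ?_⟩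
      filter_upwards [eventually_lt_of_lt_liminf h2, hT] with x hx hx'
      exact (le_div_iff₀ hx').1 (EReal.coe_lt_coe_iff.1 hx).le
  · obtain ⟨αp, αm, hαp, hαm, h⟩ := (isERV_iff (Eventually.of_forall hG)).1 hE
    have hF := herv αp αm hαp h
    refine ⟨hF, ?_⟩
    rw [hmap] at hF
    refine (isERV_iff ?_).2 ⟨αp, αm, hαp, hαm,
      h.of_asympEq_geomTailSum hG hsum hone hD_pos hF⟩
    filter_upwards [hF.eventually (lt_mem_nhds one_pos), hTpos _ hone] with x hx hx'
    exact (div_pos_iff_of_pos_right hx').1 hx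
  · have hF := herv α α hα.1 (hα.hasERVBounds hG)
    have hT := hα.tendsto_geomTailSum_div hG hone
    have hbα : (1 / b) ^ (-α) = b ^ α := by
      rw [one_div, Real.inv_rpow hb_pos.le, Real.rpow_neg hb_pos.le, inv_inv]
    have hbα1 : 0 < 1 - b ^ α := sub_pos.2 (Real.rpow_lt_one hb_pos.le hb_lt hα.1)
    rw [hbα] at hT
    have hK : ((1 - b) * c₁ + a * c₂) / ((1 - b) * (1 - b ^ α)) = D * (1 - b ^ α)⁻¹ := by
      rw [hD, div_mul_eq_div_div, div_eq_mul_inv _ (1 - b ^ α)]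
    have hKpos : 0 < D * (1 - b ^ α)⁻¹ := by positivity
    have hasymp : AsympEq (fun x => P.real {ω | x < (X ω : ℝ)})
        (fun x => D * (1 - b ^ α)⁻¹ * tail G x) := by
      -- Chains `F / (D T_{1/b}) → 1` with `T_{1/b} / tail G → (1 - b ^ α)⁻¹`.
      have h1 := hF.mul (hT.mul_const (1 - b ^ α))
      rw [inv_mul_cancel₀ hbα1.ne', one_mul] at h1
      refine h1.congr' ?_
      filter_upwards [hTpos _ hone] with x hx
      have h2 := (pos_of_mul_pos_right hx hD_pos.le).ne'
      have h3 := (hG x).ne'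
      field_simp
    rw [hK]
    refine ⟨isRV_of_tendsto_tail_div hα.1 fun y hy => ?_, hasymp⟩
    rw [← hmap]
    refine hasymp.tendsto_comp_mul_div
      (Eventually.of_forall fun x => (mul_pos hKpos (hG x)).ne') (by linarith) ?_
    refine (hα.tendsto_tail_div hG hy.le).congr fun x => ?_
    rw [mul_div_mul_left _ _ hKpos.ne']
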